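/- **Setting.** Let $\mathcal M$ be a class of monomorphisms of a category $\mathbf X$ that contains all isomorphisms and is closed under composition and stable under pullbacks and pushouts, and let $\mathbf X$ be $\mathcal M$-adhesive: pullbacks and pushouts along arrows of $\mathcal M$ exist, and every pushout along an arrow of $\mathcal M$ is an $\mathcal M$-Van Kampen square (in every commutative cube over it whose vertical arrows are in $\mathcal M$ and whose back and left faces are pullbacks, the top face is a pushout iff the front and right faces are pullbacks). Let $\mathsf R$ be a set of left $\mathcal M$-linear rules $\rho=(l:K\to L,\ r:K\to R)$, i.e. $l\in\mathcal M$. A *direct derivation* $G\Rightarrow H$ applying $\rho$ consists of arrows $m:L\to G$, $k:K\to D$, $h:R\to H$, $f:D\to G$, $g:D\to H$ such that $(l,k,m,f)$ and $(r,k,h,g)$ are pushout squares ($m\circ l=f\circ k$, $h\circ r=g\circ k$). A *derivation* is a finite, possibly empty, sequence of composable direct derivations applying rules of $\mathsf R$. Two derivations are *abstraction equivalent*, $\equiv_a$, if they apply the same rules in the same order and there are isomorphisms between their corresponding objects $G_i$ and $D_i$ that commute with all arrows $m_i,k_i,h_i,f_i,g_i$. **Independence.** Let $\mathscr D_0:G_0\Rightarrow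 G_1$ and $\mathscr D_1:G_1\Rightarrow G_2$ be direct derivations applying $\rho_0,\rho_1\in\mathsf R$. An *independence pair* is a pair $i_0:R_0\to D_1$, $i_1:L_1\to D_0$ with $f_1\circ i_0=h_0$ and $g_0\circ i_1=m_1$. Let $P$, with projections $p_0:P\to D_0$, $p_1:P\to D_1$, be the pullback of $g_0$ and $f_1$, and let $u_0:K_0\to P$, $u_1:K_1\to P$ be the arrows with $p_0u_0=k_0$, $p_1u_0=i_0r_0$, $p_0u_1=i_1l_1$, $p_1u_1=k_1$. The pair is *strong* if $(r_0,u_0,i_0,p_1)$ and $(l_1,u_1,i_1,p_0)$ are pushout squares and the pushout of $r_1$ and $u_1$ exists. The system is *well-switching* if every independence pair between consecutive direct derivations is strong, and any two consecutive direct derivations have at most one independence pair. **Switches.** A *switch* of $\mathscr D_0\cdot\mathscr D_1$ along $(i_0,i_1)$ is a derivation $\mathscr E_0\cdot\mathscr E_1$ from $G_0$ to $G_2$ applying $\rho_1$ and then $\rho_0$ (its arrows are written with primes) such that there is an independence pair $(i_0',i_1')$ between $\mathscr E_0$ and $\mathscr E_1$ with $$m_0=f_0'\circ i_1',\quad h_1=g_1'\circ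 i_0',\quad m_0'=f_0\circ i_1,\quad h_1'=g_1\circ i_0,$$ and there are arrows $q_0:P\to D_0'$, $q_1:P\to D_1'$ with $$f_0'\circ q_0=f_0\circ p_0,\quad g_0'\circ q_0=f_1'\circ q_1,\quad g_1'\circ q_1=g_1\circ p_1 .$$ For derivations $\mathscr D,\mathscr E$ of the same length, with steps numbered from $0$, write $\mathscr D\leftrightsquigarrow_{(i,i+1)}\mathscr E$ if the steps $i,i+1$ of $\mathscr D$ form a switch (along some independence pair) of the steps $i,i+1$ of $\mathscr E$ and all other steps of $\mathscr D$ and $\mathscr E$ coincide. For transpositions $\nu_1,\dots,\nu_n$ put $\nu_{i,n}=\nu_n\circ\dots\circ\nu_i$. For a permutation $\tau$ of step positions, $\mathrm{inv}(\tau)=\{(i,j)\mid i<j,\ \tau(j)<\tau(i)\}$. Derivations $\mathscr D,\mathscr D'$ are *switch equivalent via* $\sigma$ if there are $n\ge 0$ and derivations $\mathscr D_0,\dots,\mathscr D_n$ with $$\mathscr D\equiv_a\mathscr D_0\leftrightsquigarrow_{\nu_1}\mathscr D_1\leftrightsquigarrow_{\nu_2}\cdots\leftrightsquigarrow_{\nu_n}\mathscr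 D_n\equiv_a\mathscr D',$$ where each $\nu_i$ is a transposition of two adjacent positions and $\nu_{1,n}=\sigma$. **Corollary (Canonical form).** Suppose that $(\mathbf X,\mathsf R)$ is well-switching and that the derivations $\mathscr D$ and $\mathscr D'$ are switch equivalent via a permutation $\sigma$. Then there are $n\ge0$ and a switching sequence $$\mathscr D\equiv_a\mathscr D_0\leftrightsquigarrow_{\nu_1}\mathscr D_1\leftrightsquigarrow_{\nu_2}\cdots\leftrightsquigarrow_{\nu_n}\mathscr D_n\equiv_a\mathscr D'$$ with $\nu_{1,n}=\sigma$ such that for every $i\in\{1,\dots,n\}$ one has $\nu_i=(k,k+1)$ with $$k=\max\{\,j\mid (j,j+1)\in\mathrm{inv}(\nu_{i,n})\,\}.$$ Moreover, the sequence $\nu_1,\dots,\nu_n$ with these properties is unique, so it is a canonical form. -/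

import Mathlib

open CategoryTheory CategoryTheory.Limits

universe v u

namespace DPO

/-! ### `M`-adhesive categories -/

section Adhesive

variable {C : Type u} [Category.{v} C]

/-- A commutative square with sides `f`, `m`, `n`, `g` is an
`M`-Van Kampen square if it is a pushout and, in every commutative cube over it whose vertical
arrows lie in `M` and whose two faces over `f` and `m` are pullbacks, the top face is a pushout
if and only if the faces over `n` and `g` are pullbacks. -/
def IsVanKampenSquare (M : MorphismProperty C) {X Y Z W : C}
    (f : X ⟶ Y) (m : X ⟶ Z) (n : Y ⟶ W) (g : Z ⟶ W) : Prop :=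
  IsPushout f m n g ∧
    ∀ ⦃X' Y' Z' W' : C⦄ (f' : X' ⟶ Y') (m' : X' ⟶ Z') (n' : Y' ⟶ W') (g' : Z' ⟶ W')
      (a : X' ⟶ X) (b : Y' ⟶ Y) (c : Z' ⟶ Z) (d : W' ⟶ W),
      M a → M b → M c → M d →
      IsPullback f' a b f → IsPullback m' a c m →
      CommSq n' b d n → CommSq g' c d g → CommSq f' m' n' g' →
      (IsPushout f' m' n' g' ↔ IsPullback n' b d n ∧ IsPullback g' c d g)

/-- `C` is an `M`-adhesive category. -/
structure IsMAdhesive (M : MorphismProperty C) : Prop where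
  le_mono : M ≤ MorphismProperty.monomorphisms C
  iso_le : MorphismProperty.isomorphisms C ≤ M
  comp : M.IsStableUnderComposition
  pullback : M.IsStableUnderBaseChange
  pushout : M.IsStableUnderCobaseChange
  hasPullback : ∀ ⦃X Y Z : C⦄ (f : X ⟶ Z) (m : Y ⟶ Z), M m → HasPullback f m
  hasPushout : ∀ ⦃X Y Z : C⦄ (f : X ⟶ Y) (m : X ⟶ Z), M m → HasPushout f m
  vanKampen : ∀ ⦃X Y Z W : C⦄ (f : X ⟶ Y) (m : X ⟶ Z) (n : Y ⟶ W) (g : Z ⟶ W),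
    M m → IsPushout f m n g → IsVanKampenSquare M f m n g

end Adhesive

/-! ### Rules, direct derivations, derivations -/

/-- A rule `L ⟵l K ⟶r R`. -/
structure Rule (C : Type u) [Category.{v} C] where
  L : C
  K : C
  R : C
  l : K ⟶ L
  r : K ⟶ R

section Rewriting

variable {C : Type u} [Category.{v} C]

/-- A set of rules is left `M`-linear if the left leg of each of its rules is in `M`. -/
def IsLeftLinear (M : MorphismProperty C) (R : Set (Rule C)) : Prop :=
  ∀ ρ ∈ R, M ρ.l

/-- A direct derivation from `G` to `H` applying `ρ`: a double pushout diagram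
with match `m` and co-match `h`. -/
structure DirectDerivation (ρ : Rule C) (G H : C) where
  D : C
  m : ρ.L ⟶ G
  k : ρ.K ⟶ D
  h : ρ.R ⟶ H
  f : D ⟶ G
  g : D ⟶ H
  left : IsPushout ρ.l k m f
  right : IsPushout ρ.r k h g

/-- Derivations: finite, possibly empty, sequences of composable direct derivations
applying rules of `R`. -/
inductive Derivation (R : Set (Rule C)) : C → C → Type (max u v)
  | nil (G : C) : Derivation R G G
  | cons {G H F : C} {ρ : Rule C} (hρ : ρ ∈ R) (d : DirectDerivation ρ G H)
      (t : Derivation R H F) : Derivation R G F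

/-- Two direct derivations applying the same rule are isomorphic via `φ` on the sources and
`ψ` on the targets. -/
def DirectDerivation.IsoVia {ρ : Rule C} {G H G' H' : C} (φ : G ≅ G') (ψ : H ≅ H')
    (d : DirectDerivation ρ G H) (d' : DirectDerivation ρ G' H') : Prop :=
  ∃ χ : d.D ≅ d'.D,
    d.m ≫ φ.hom = d'.m ∧ d.k ≫ χ.hom = d'.k ∧ d.h ≫ ψ.hom = d'.h ∧
      d.f ≫ φ.hom = χ.hom ≫ d'.f ∧ d.g ≫ ψ.hom = χ.hom ≫ d'.g

/-- `AbsEquivVia φ D D'`: the derivations `D` and `D'` have the same length, apply the same rules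
in the same order, and there is a compatible family of isomorphisms between their objects whose
component at the sources is `φ`. -/
inductive AbsEquivVia {R : Set (Rule C)} :
    ∀ {G H G' H' : C}, (G ≅ G') → Derivation R G H → Derivation R G' H' → Prop
  | nil {G G' : C} (φ : G ≅ G') : AbsEquivVia φ (Derivation.nil G) (Derivation.nil G')
  | cons {G H F G' H' F' : C} {ρ : Rule C} (hρ : ρ ∈ R) (φ : G ≅ G') (ψ : H ≅ H')
      (d : DirectDerivation ρ G H) (d' : DirectDerivation ρ G' H')
      (t : Derivation R H F) (t' : Derivation R H' F') :
      d.IsoVia φ ψ d' → AbsEquivVia ψ t t' →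
      AbsEquivVia φ (Derivation.cons hρ d t) (Derivation.cons hρ d' t')

/-- Abstraction equivalence of derivations. -/
def AbsEquiv {R : Set (Rule C)} {G H G' H' : C}
    (D : Derivation R G H) (D' : Derivation R G' H') : Prop :=
  ∃ φ : G ≅ G', AbsEquivVia φ D D'

/-! ### Independence and switches -/

/-- An independence pair between two consecutive direct derivations. -/
structure IndependencePair {ρ₀ ρ₁ : Rule C} {G₀ G₁ G₂ : C}
    (d₀ : DirectDerivation ρ₀ G₀ G₁) (d₁ : DirectDerivation ρ₁ G₁ G₂) where
  i₀ : ρ₀.R ⟶ d₁.D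
  i₁ : ρ₁.L ⟶ d₀.D
  fac₀ : i₀ ≫ d₁.f = d₀.h
  fac₁ : i₁ ≫ d₀.g = d₁.m

/-- Strong independence pairs. Here `P` is the pullback of `d₀.g` and `d₁.f`, and `u₀`, `u₁` are
the (unique) mediating arrows into it. -/
def IndependencePair.IsStrong {ρ₀ ρ₁ : Rule C} {G₀ G₁ G₂ : C}
    {d₀ : DirectDerivation ρ₀ G₀ G₁} {d₁ : DirectDerivation ρ₁ G₁ G₂}
    (p : IndependencePair d₀ d₁) : Prop :=
  ∃ (P : C) (p₀ : P ⟶ d₀.D) (p₁ : P ⟶ d₁.D) (u₀ : ρ₀.K ⟶ P) (u₁ : ρ₁.K ⟶ P),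
    IsPullback p₀ p₁ d₀.g d₁.f ∧
    u₀ ≫ p₀ = d₀.k ∧ u₀ ≫ p₁ = ρ₀.r ≫ p.i₀ ∧
    u₁ ≫ p₀ = ρ₁.l ≫ p.i₁ ∧ u₁ ≫ p₁ = d₁.k ∧
    IsPushout ρ₀.r u₀ p.i₀ p₁ ∧
    IsPushout ρ₁.l u₁ p.i₁ p₀ ∧
    HasPushout ρ₁.r u₁

/-- Every independence pair between two consecutive direct derivations is strong. -/
def IsStrongEnforcing (R : Set (Rule C)) : Prop :=
  ∀ ⦃ρ₀ ρ₁ : Rule C⦄, ρ₀ ∈ R → ρ₁ ∈ R → ∀ ⦃G₀ G₁ G₂ : C⦄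
    (d₀ : DirectDerivation ρ₀ G₀ G₁) (d₁ : DirectDerivation ρ₁ G₁ G₂)
    (p : IndependencePair d₀ d₁), p.IsStrong

/-- Strong enforcing, with at most one independence pair between two consecutive direct
derivations. -/
def IsWellSwitching (R : Set (Rule C)) : Prop :=
  IsStrongEnforcing R ∧
    ∀ ⦃ρ₀ ρ₁ : Rule C⦄, ρ₀ ∈ R → ρ₁ ∈ R → ∀ ⦃G₀ G₁ G₂ : C⦄
      (d₀ : DirectDerivation ρ₀ G₀ G₁) (d₁ : DirectDerivation ρ₁ G₁ G₂)
      (p p' : IndependencePair d₀ d₁), p = p'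

/-- `e₀ · e₁` is a switch of `d₀ · d₁` along the independence pair `p`. The first conjunct
relates matches and co-matches. The second says that the part `P` of `G₁` preserved by both steps
is embedded in the same way into `G₀` and into `G₂` by the two derivations. -/
def IsSwitchAlong {ρ₀ ρ₁ : Rule C} {G₀ G₁ G₁' G₂ : C}
    {d₀ : DirectDerivation ρ₀ G₀ G₁} {d₁ : DirectDerivation ρ₁ G₁ G₂}
    (p : IndependencePair d₀ d₁)
    (e₀ : DirectDerivation ρ₁ G₀ G₁') (e₁ : DirectDerivation ρ₀ G₁' G₂) : Prop :=
  (∃ p' : IndependencePair e₀ e₁,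
    d₀.m = p'.i₁ ≫ e₀.f ∧ d₁.h = p'.i₀ ≫ e₁.g ∧
    e₀.m = p.i₁ ≫ d₀.f ∧ e₁.h = p.i₀ ≫ d₁.g) ∧
  (∃ (P : C) (p₀ : P ⟶ d₀.D) (p₁ : P ⟶ d₁.D) (q₀ : P ⟶ e₀.D) (q₁ : P ⟶ e₁.D),
    IsPullback p₀ p₁ d₀.g d₁.f ∧
    q₀ ≫ e₀.f = p₀ ≫ d₀.f ∧ q₀ ≫ e₀.g = q₁ ≫ e₁.f ∧ q₁ ≫ e₁.g = p₁ ≫ d₁.g)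

/-- `e₀ · e₁` is a switch of `d₀ · d₁`, along some independence pair. -/
def IsSwitch {ρ₀ ρ₁ : Rule C} {G₀ G₁ G₁' G₂ : C}
    (d₀ : DirectDerivation ρ₀ G₀ G₁) (d₁ : DirectDerivation ρ₁ G₁ G₂)
    (e₀ : DirectDerivation ρ₁ G₀ G₁') (e₁ : DirectDerivation ρ₀ G₁' G₂) : Prop :=
  ∃ p : IndependencePair d₀ d₁, IsSwitchAlong p e₀ e₁

/-- `Shift i D E`: the steps `i, i + 1` of `D` (numbered from `0`) are a switch of the steps
`i, i + 1` of `E`, and all other steps of `D` and `E` coincide. -/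
inductive Shift {R : Set (Rule C)} :
    ∀ {G H : C}, ℕ → Derivation R G H → Derivation R G H → Prop
  | head {G₀ G₁ G₁' G₂ H : C} {ρ₀ ρ₁ : Rule C} (h₀ : ρ₀ ∈ R) (h₁ : ρ₁ ∈ R)
      (d₀ : DirectDerivation ρ₀ G₀ G₁) (d₁ : DirectDerivation ρ₁ G₁ G₂)
      (e₀ : DirectDerivation ρ₁ G₀ G₁') (e₁ : DirectDerivation ρ₀ G₁' G₂)
      (t : Derivation R G₂ H) :
      IsSwitch e₀ e₁ d₀ d₁ →
      Shift 0 (Derivation.cons h₀ d₀ (Derivation.cons h₁ d₁ t))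
        (Derivation.cons h₁ e₀ (Derivation.cons h₀ e₁ t))
  | tail {G H F : C} {ρ : Rule C} {i : ℕ} (hρ : ρ ∈ R) (d : DirectDerivation ρ G H)
      (t t' : Derivation R H F) :
      Shift i t t' → Shift (i + 1) (Derivation.cons hρ d t) (Derivation.cons hρ d t')

/-- `SwitchSeq [i₁, …, iₘ] D E`: there is a switching sequence from `D` to `E` whose `k`-th
step switches positions `iₖ` and `iₖ + 1`. -/
inductive SwitchSeq {R : Set (Rule C)} {G H : C} :
    List ℕ → Derivation R G H → Derivation R G H → Prop
  | nil (D : Derivation R G H) : SwitchSeq [] D D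
  | cons {i : ℕ} {w : List ℕ} (D E F : Derivation R G H) :
      Shift i D E → SwitchSeq w E F → SwitchSeq (i :: w) D F

/-- There are derivations `D₀`, `Dₘ` with `D ≡ₐ D₀`, `Dₘ ≡ₐ D'` and a switching sequence with
positions `w` from `D₀` to `Dₘ`. -/
def SwitchesTo {R : Set (Rule C)} {G H G' H' : C} (w : List ℕ)
    (D : Derivation R G H) (D' : Derivation R G' H') : Prop :=
  ∃ (G₀ H₀ : C) (D₀ Dₘ : Derivation R G₀ H₀),
    AbsEquiv D D₀ ∧ SwitchSeq w D₀ Dₘ ∧ AbsEquiv Dₘ D'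

end Rewriting

/-! ### Permutations -/

/-- The composite `νₘ ∘ ⋯ ∘ ν₁` of the transpositions `νₖ = (iₖ, iₖ + 1)`, for a list
`[i₁, …, iₘ]`. A permutation of `{0, …, n}` is regarded as a permutation of `ℕ` that fixes all
other numbers. -/
def composite : List ℕ → Equiv.Perm ℕ
  | [] => 1
  | i :: w => composite w * Equiv.swap i (i + 1)

/-- The set of inversions of a permutation. -/
def inversions (σ : Equiv.Perm ℕ) : Set (ℕ × ℕ) :=
  {p | p.1 < p.2 ∧ σ p.2 < σ p.1}

/-- Every entry of the list is the largest `j` such that `(j, j + 1)` is an inversion of the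
composite of the transpositions from that entry on. -/
def IsCanonical (w : List ℕ) : Prop :=
  ∀ (k : ℕ) (hk : k < w.length),
    IsGreatest {j : ℕ | (j, j + 1) ∈ inversions (composite (w.drop k))} w[k]

/-- Switch equivalence via the permutation `σ`. -/
def SwitchEquiv {C : Type u} [Category.{v} C] {R : Set (Rule C)} {G H G' H' : C}
    (σ : Equiv.Perm ℕ) (D : Derivation R G H) (D' : Derivation R G' H') : Prop :=
  ∃ w : List ℕ, composite w = σ ∧ SwitchesTo w D D'

end DPO

namespace DPO

variable {C : Type u} [Category.{v} C]

/-! ### Pushouts along `M` -/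

namespace IsMAdhesive

variable {M : MorphismProperty C}

/-! A switching sequence spells a word in adjacent transpositions, and the proof separates the
combinatorics of words from the category theory of switches.

On words, `WordReduces` allows cancellation of a repeated letter, commutation of distant letters,
and the braid relation in one direction only. This suffices to bring any word to a concatenation of
ascending runs whose first letters increase towards the front: the smallest letter is collected in a
single run at the end (`exists_append_Ico`), and the rest is treated recursively. Such a word is
canonical (`exists_isCanonical`). A canonical word is recovered from its composite letter by letter,
since its head is the greatest descent (`IsCanonical.ext`); this gives uniqueness.

On derivations, each reduction lifts to switching sequences up to isomorphism
(`WordReduces.exists_switchSeq`). Commutation concerns disjoint steps. Cancellation holds because a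
switch can be undone and switches along the same independence pair are isomorphic; here uniqueness
of independence pairs enters. The braid relation (`SwitchSquare.braid`) is the hard case: strong
enforcing supplies the other three switches, uniqueness of pushout complements along `M` compares
matches, and the Van Kampen property shows that the comparison is the identity on the final object.

Both facts about switches use `SwitchSquare`, a symmetric form of a switch with four pushouts around
the common preserved part. -/

theorem mono (hM : IsMAdhesive M) {X Y : C} {f : X ⟶ Y} (hf : M f) : Mono f :=
  hM.le_mono f hf

theorem of_isIso (hM : IsMAdhesive M) {X Y : C} (f : X ⟶ Y) [IsIso f] : M f :=
  hM.iso_le f (MorphismProperty.isomorphisms.infer_property f)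

theorem of_isPushout (hM : IsMAdhesive M) {X Y Z W : C} {f : X ⟶ Y} {m : X ⟶ Z} {n : Y ⟶ W} {g : Z ⟶ W}
    (sq : IsPushout f m n g) (hm : M m) : M n :=
  have := hM.pushout
  MorphismProperty.of_isPushout sq hm

theorem of_isPullback (hM : IsMAdhesive M) {X Y Z W : C} {f : X ⟶ Y} {m : X ⟶ Z} {n : Y ⟶ W} {g : Z ⟶ W}
    (sq : IsPullback f m n g) (hn : M n) : M m :=
  have := hM.pullback
  MorphismProperty.of_isPullback sq hn

/-- Pushouts along `M` are pullbacks. -/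
theorem isPullback (hM : IsMAdhesive M) {X Y Z W : C} {f : X ⟶ Y} {m : X ⟶ Z} {n : Y ⟶ W} {g : Z ⟶ W}
    (sq : IsPushout f m n g) (hm : M m) : IsPullback f m n g := by
  have := hM.mono hm
  have hn := hM.of_isPushout sq hm
  have := hM.mono hn
  -- A cube whose top face is the trivial pushout of `f` along an identity and whose face over `g`
  -- is the square itself.
  have h := (hM.vanKampen f m n g hm sq).2 f (𝟙 X) (𝟙 Y) f (𝟙 X) (𝟙 Y) m n
    (hM.of_isIso _) (hM.of_isIso _) hm hn
    (IsPullback.of_vert_isIso ⟨by simp⟩) (IsKernelPair.id_of_mono m)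
    ⟨by simp⟩ ⟨sq.w⟩ ⟨by simp⟩
  exact (h.1 (IsPushout.of_vert_isIso ⟨by simp⟩)).2

/-- Pushout complements along `M` are unique: one half of the isomorphism. -/
theorem isIso_snd_of_isPushout (hM : IsMAdhesive M) {K L G D D' U : C} {l : K ⟶ L} {m : L ⟶ G} {k : K ⟶ D}
    {f : D ⟶ G} {k' : K ⟶ D'} {f' : D' ⟶ G} (hl : M l) (sq : IsPushout l k m f)
    (sq' : IsPushout l k' m f') {a : U ⟶ D} {b : U ⟶ D'} (hU : IsPullback a b f f') :
    IsIso b := by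
  have := hM.mono hl
  have hf' := hM.of_isPushout sq'.flip hl
  have hf := hM.of_isPushout sq.flip hl
  have := hM.mono hf'
  have ha : M a := hM.of_isPullback hU.flip hf'
  have := hM.mono ha
  have w : k ≫ f = k' ≫ f' := by rw [← sq.w, sq'.w]
  have hs := hU.lift_fst k k' w
  -- Pull `sq` back along `f'`: over `D` this gives `U`, over `L` it gives `K` since `sq'` is a
  -- pullback. The top face then exhibits `b` as a pushout of `𝟙 K`.
  have h := (hM.vanKampen k l f m hl sq.flip).2 (hU.lift k k' w) (𝟙 K) b k' (𝟙 K) a l f'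
    (hM.of_isIso _) ha hl hf'
    ⟨⟨by simp⟩, ⟨PullbackCone.IsLimit.mk _ (fun s => s.snd)
      (fun s => by
        rw [← cancel_mono a, Category.assoc, hs]; exact s.condition.symm)
      (fun s => by simp) (fun s t _ h => by simpa using h)⟩⟩
    (IsKernelPair.id_of_mono l)
    ⟨hU.w.symm⟩ ⟨sq'.w.symm⟩ ⟨by simp⟩
  have top := h.2 ⟨hU.flip, (hM.isPullback sq'.flip hl)⟩
  exact top.isIso_inl_of_isIso

/-- Pushout complements along `M` are unique. -/
theorem exists_iso_of_isPushout (hM : IsMAdhesive M) {K L G D D' : C} {l : K ⟶ L} {m : L ⟶ G} {k : K ⟶ D}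
    {f : D ⟶ G} {k' : K ⟶ D'} {f' : D' ⟶ G} (hl : M l) (sq : IsPushout l k m f)
    (sq' : IsPushout l k' m f') : ∃ χ : D ≅ D', k ≫ χ.hom = k' ∧ χ.hom ≫ f' = f := by
  have hf' := hM.of_isPushout sq'.flip hl
  have := hM.mono hf'
  have := hM.hasPullback f f' hf'
  have hU := IsPullback.of_hasPullback f f'
  have := hM.isIso_snd_of_isPushout hl sq sq' hU
  have := hM.isIso_snd_of_isPushout hl sq' sq hU.flip
  have e : (inv (pullback.fst f f') ≫ pullback.snd f f') ≫ f' = f := by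
    rw [Category.assoc, IsIso.inv_comp_eq]; exact hU.w.symm
  refine ⟨asIso (inv (pullback.fst f f') ≫ pullback.snd f f'), ?_, e⟩
  rw [← cancel_mono f', Category.assoc, asIso_hom, e, ← sq'.w, sq.w]

end IsMAdhesive

theorem isPushout_of_iso_right {X Y Z W Z' : C} {f : X ⟶ Y} {g : X ⟶ Z} {n : Y ⟶ W} {h : Z ⟶ W}
    (sq : IsPushout f g n h) (e : Z ≅ Z') {g' : X ⟶ Z'} {h' : Z' ⟶ W} (hg : g ≫ e.hom = g')
    (hh : e.hom ≫ h' = h) : IsPushout f g' n h' :=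
  sq.of_iso (Iso.refl _) (Iso.refl _) e (Iso.refl _) (by simp) (by simp [hg]) (by simp)
    (by simp [hh])

/-! ### Direct derivations with isomorphic matches -/

namespace DirectDerivation

variable {M : MorphismProperty C} {ρ : Rule C} {G H G' H' : C}

theorem f_mem (hM : IsMAdhesive M) (hρ : M ρ.l) (d : DirectDerivation ρ G H) : M d.f :=
  hM.of_isPushout d.left.flip hρ

/-- Direct derivations with isomorphic matches are isomorphic. -/
theorem exists_iso_of_match (hM : IsMAdhesive M) (hρ : M ρ.l) (d : DirectDerivation ρ G H)
    (d' : DirectDerivation ρ G' H') (φ : G ≅ G') (hm : d.m ≫ φ.hom = d'.m) :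
    ∃ (ψ : H ≅ H') (χ : d.D ≅ d'.D),
      d.k ≫ χ.hom = d'.k ∧ d.h ≫ ψ.hom = d'.h ∧
      d.f ≫ φ.hom = χ.hom ≫ d'.f ∧ d.g ≫ ψ.hom = χ.hom ≫ d'.g := by
  have sq : IsPushout ρ.l d.k d'.m (d.f ≫ φ.hom) :=
    d.left.of_iso (Iso.refl _) (Iso.refl _) (Iso.refl _) φ (by simp) (by simp) (by simp [hm])
      (by simp)
  obtain ⟨χ, hk, hf⟩ := hM.exists_iso_of_isPushout hρ sq d'.left
  have sq' : IsPushout ρ.r d.k d'.h (χ.hom ≫ d'.g) :=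
    d'.right.of_iso (Iso.refl _) (Iso.refl _) χ.symm (Iso.refl _) (by simp) (by simp [← hk])
      (by simp) (by simp)
  refine ⟨d.right.isoIsPushout _ _ sq', χ, hk, ?_, hf.symm, ?_⟩ <;> simp

end DirectDerivation

/-! ### Symmetric description of switches -/

/-- Two consecutive direct derivations and a switch of them, arranged around the part `P` that is
preserved by all of them. -/
structure SwitchSquare {ρ₀ ρ₁ : Rule C} {G₀ G₁ G₁' G₂ : C}
    (d₀ : DirectDerivation ρ₀ G₀ G₁) (d₁ : DirectDerivation ρ₁ G₁ G₂)
    (e₀ : DirectDerivation ρ₁ G₀ G₁') (e₁ : DirectDerivation ρ₀ G₁' G₂) where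
  P : C
  p₀ : P ⟶ d₀.D
  p₁ : P ⟶ d₁.D
  q₀ : P ⟶ e₀.D
  q₁ : P ⟶ e₁.D
  u₀ : ρ₀.K ⟶ P
  u₁ : ρ₁.K ⟶ P
  i₀ : ρ₀.R ⟶ d₁.D
  i₁ : ρ₁.L ⟶ d₀.D
  j₀ : ρ₁.R ⟶ e₁.D
  j₁ : ρ₀.L ⟶ e₀.D
  isPushout_i₀ : IsPushout ρ₀.r u₀ i₀ p₁
  isPushout_i₁ : IsPushout ρ₁.l u₁ i₁ p₀
  isPushout_j₀ : IsPushout ρ₁.r u₁ j₀ q₁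
  isPushout_j₁ : IsPushout ρ₀.l u₀ j₁ q₀
  i₀_f : i₀ ≫ d₁.f = d₀.h
  i₁_g : i₁ ≫ d₀.g = d₁.m
  j₀_f : j₀ ≫ e₁.f = e₀.h
  j₁_g : j₁ ≫ e₀.g = e₁.m
  i₀_g : i₀ ≫ d₁.g = e₁.h
  i₁_f : i₁ ≫ d₀.f = e₀.m
  j₀_g : j₀ ≫ e₁.g = d₁.h
  j₁_f : j₁ ≫ e₀.f = d₀.m
  u₀_p₀ : u₀ ≫ p₀ = d₀.k
  u₁_p₁ : u₁ ≫ p₁ = d₁.k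
  u₁_q₀ : u₁ ≫ q₀ = e₀.k
  u₀_q₁ : u₀ ≫ q₁ = e₁.k
  w₀ : p₀ ≫ d₀.f = q₀ ≫ e₀.f
  w : p₀ ≫ d₀.g = p₁ ≫ d₁.f
  w' : q₀ ≫ e₀.g = q₁ ≫ e₁.f
  w₂ : p₁ ≫ d₁.g = q₁ ≫ e₁.g

namespace SwitchSquare

variable {ρ₀ ρ₁ : Rule C} {G₀ G₁ G₁' G₂ : C}
  {d₀ : DirectDerivation ρ₀ G₀ G₁} {d₁ : DirectDerivation ρ₁ G₁ G₂}
  {e₀ : DirectDerivation ρ₁ G₀ G₁'} {e₁ : DirectDerivation ρ₀ G₁' G₂}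

/-- A switch can be undone. -/
def symm (s : SwitchSquare d₀ d₁ e₀ e₁) : SwitchSquare e₀ e₁ d₀ d₁ where
  P := s.P
  p₀ := s.q₀
  p₁ := s.q₁
  q₀ := s.p₀
  q₁ := s.p₁
  u₀ := s.u₁
  u₁ := s.u₀
  i₀ := s.j₀
  i₁ := s.j₁
  j₀ := s.i₀
  j₁ := s.i₁
  isPushout_i₀ := s.isPushout_j₀
  isPushout_i₁ := s.isPushout_j₁
  isPushout_j₀ := s.isPushout_i₀
  isPushout_j₁ := s.isPushout_i₁
  i₀_f := s.j₀_f
  i₁_g := s.j₁_g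
  j₀_f := s.i₀_f
  j₁_g := s.i₁_g
  i₀_g := s.j₀_g
  i₁_f := s.j₁_f
  j₀_g := s.i₀_g
  j₁_f := s.i₁_f
  u₀_p₀ := s.u₁_q₀
  u₁_p₁ := s.u₀_q₁
  u₁_q₀ := s.u₀_p₀
  u₀_q₁ := s.u₁_p₁
  w₀ := s.w₀.symm
  w := s.w'
  w' := s.w
  w₂ := s.w₂.symm

/-- The independence pair of the first two derivations. -/
def pair (s : SwitchSquare d₀ d₁ e₀ e₁) : IndependencePair d₀ d₁ :=
  ⟨s.i₀, s.i₁, s.i₀_f, s.i₁_g⟩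

/-- The left square of `d₀` factors through `P`; cancelling the upper pushout leaves this one. -/
theorem isPushout_source (s : SwitchSquare d₀ d₁ e₀ e₁) : IsPushout s.q₀ s.p₀ e₀.f d₀.f := by
  have h : IsPushout ρ₀.l (s.u₀ ≫ s.p₀) (s.j₁ ≫ e₀.f) d₀.f := by
    rw [s.u₀_p₀, s.j₁_f]; exact d₀.left
  exact h.of_top s.w₀.symm s.isPushout_j₁

theorem isPushout_target (s : SwitchSquare d₀ d₁ e₀ e₁) : IsPushout s.p₁ s.p₀ d₁.f d₀.g := by
  have h : IsPushout ρ₀.r (s.u₀ ≫ s.p₀) (s.i₀ ≫ d₁.f) d₀.g := by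
    rw [s.u₀_p₀, s.i₀_f]; exact d₀.right
  exact h.of_top s.w.symm s.isPushout_i₀

variable {M : MorphismProperty C}

theorem p₀_mem (hM : IsMAdhesive M) (hρ₁ : M ρ₁.l) (s : SwitchSquare d₀ d₁ e₀ e₁) : M s.p₀ :=
  hM.of_isPushout s.isPushout_i₁.flip hρ₁

theorem q₀_mem (hM : IsMAdhesive M) (hρ₀ : M ρ₀.l) (s : SwitchSquare d₀ d₁ e₀ e₁) : M s.q₀ :=
  hM.of_isPushout s.isPushout_j₁.flip hρ₀

theorem isPullback_source (hM : IsMAdhesive M) (hρ₁ : M ρ₁.l) (s : SwitchSquare d₀ d₁ e₀ e₁) :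
    IsPullback s.p₀ s.q₀ d₀.f e₀.f :=
  (hM.isPullback s.isPushout_source (s.p₀_mem hM hρ₁)).flip

theorem isPullback_target (hM : IsMAdhesive M) (hρ₁ : M ρ₁.l) (s : SwitchSquare d₀ d₁ e₀ e₁) :
    IsPullback s.p₀ s.p₁ d₀.g d₁.f :=
  (hM.isPullback s.isPushout_target (s.p₀_mem hM hρ₁)).flip

theorem isSwitch (hM : IsMAdhesive M) (hρ₁ : M ρ₁.l) (s : SwitchSquare d₀ d₁ e₀ e₁) : IsSwitch d₀ d₁ e₀ e₁ :=
  ⟨s.pair, ⟨s.symm.pair, s.j₁_f.symm, s.j₀_g.symm, s.i₁_f.symm, s.i₀_g.symm⟩,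
    s.P, s.p₀, s.p₁, s.q₀, s.q₁, s.isPullback_target hM hρ₁, s.w₀.symm, s.w', s.w₂.symm⟩

/-- Strong independence pairs can be switched. -/
theorem exists_of_isStrong (hM : IsMAdhesive M) (hρ₀ : M ρ₀.l) (p : IndependencePair d₀ d₁)
    (hp : p.IsStrong) :
    ∃ (G₁' : C) (e₀ : DirectDerivation ρ₁ G₀ G₁') (e₁ : DirectDerivation ρ₀ G₁' G₂)
      (s : SwitchSquare d₀ d₁ e₀ e₁), s.i₀ = p.i₀ ∧ s.i₁ = p.i₁ := by
  obtain ⟨P, p₀, p₁, u₀, u₁, hP, h₀, h₀', h₁, h₁', sq₀, sq₁, hr⟩ := hp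
  have := hM.hasPushout u₀ ρ₀.l hρ₀
  have sqj₁ : IsPushout ρ₀.l u₀ _ _ := (IsPushout.of_hasPushout u₀ ρ₀.l).flip
  have sqj₀ : IsPushout ρ₁.r u₁ _ _ := IsPushout.of_hasPushout ρ₁.r u₁
  set j₁ := pushout.inr u₀ ρ₀.l
  set q₀ := pushout.inl u₀ ρ₀.l
  set j₀ := pushout.inl ρ₁.r u₁
  set q₁ := pushout.inr ρ₁.r u₁
  have hq₀ : M q₀ := hM.of_isPushout sqj₁.flip hρ₀
  have := hM.hasPushout q₁ q₀ hq₀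
  have sq' : IsPushout q₁ q₀ _ _ := IsPushout.of_hasPushout q₁ q₀
  set f' := pushout.inl q₁ q₀
  set g' := pushout.inr q₁ q₀
  have wf : ρ₀.l ≫ d₀.m = u₀ ≫ p₀ ≫ d₀.f := by rw [reassoc_of% h₀, d₀.left.w]
  have wg : ρ₁.r ≫ d₁.h = u₁ ≫ p₁ ≫ d₁.g := by rw [reassoc_of% h₁', d₁.right.w]
  set f := sqj₁.desc d₀.m (p₀ ≫ d₀.f) wf
  set g := sqj₀.desc d₁.h (p₁ ≫ d₁.g) wg
  have f₁ : j₁ ≫ f = d₀.m := sqj₁.inl_desc _ _ wf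
  have f₂ : q₀ ≫ f = p₀ ≫ d₀.f := sqj₁.inr_desc _ _ wf
  have g₁ : j₀ ≫ g = d₁.h := sqj₀.inl_desc _ _ wg
  have g₂ : q₁ ≫ g = p₁ ≫ d₁.g := sqj₀.inr_desc _ _ wg
  have sqf : IsPushout p₀ q₀ d₀.f f := by
    have h : IsPushout ρ₀.l (u₀ ≫ p₀) (j₁ ≫ f) d₀.f := by rw [h₀, f₁]; exact d₀.left
    exact (h.of_top f₂ sqj₁).flip
  have sqg : IsPushout p₁ q₁ d₁.g g := by
    have h : IsPushout ρ₁.r (u₁ ≫ p₁) (j₀ ≫ g) d₁.g := by rw [h₁', g₁]; exact d₁.right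
    exact (h.of_top g₂ sqj₀).flip
  -- All four squares of the new steps are pasted from a pushout out of `P` and one of `sqf`, `sqg`,
  -- `sq'`.
  let e₀ : DirectDerivation ρ₁ G₀ (pushout q₁ q₀) :=
    { D := _
      m := p.i₁ ≫ d₀.f
      k := u₁ ≫ q₀
      h := j₀ ≫ f'
      f := f
      g := g'
      left := sq₁.paste_vert sqf
      right := sqj₀.paste_vert sq' }
  let e₁ : DirectDerivation ρ₀ (pushout q₁ q₀) G₂ :=
    { D := _
      m := j₁ ≫ g'
      k := u₀ ≫ q₁
      h := p.i₀ ≫ d₁.g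
      f := f'
      g := g
      left := sqj₁.paste_vert sq'.flip
      right := sq₀.paste_vert sqg }
  refine ⟨_, e₀, e₁,
    { P := P, p₀ := p₀, p₁ := p₁, q₀ := q₀, q₁ := q₁, u₀ := u₀, u₁ := u₁
      i₀ := p.i₀, i₁ := p.i₁, j₀ := j₀, j₁ := j₁
      isPushout_i₀ := sq₀, isPushout_i₁ := sq₁, isPushout_j₀ := sqj₀, isPushout_j₁ := sqj₁
      i₀_f := p.fac₀, i₁_g := p.fac₁, j₀_f := rfl, j₁_g := rfl
      i₀_g := rfl, i₁_f := rfl, j₀_g := g₁, j₁_f := f₁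
      u₀_p₀ := h₀, u₁_p₁ := h₁', u₁_q₀ := rfl, u₀_q₁ := rfl
      w₀ := f₂.symm, w := hP.w, w' := sq'.w.symm, w₂ := g₂.symm }, rfl, rfl⟩

/-- A switch along a strong independence pair is a switch square, if the reverse independence pair
is strong as well. -/
theorem nonempty_of_isSwitchAlong (hM : IsMAdhesive M) (hρ₀ : M ρ₀.l) (hρ₁ : M ρ₁.l)
    (hs : ∀ p : IndependencePair e₀ e₁, p.IsStrong) {p : IndependencePair d₀ d₁}
    (hp : p.IsStrong) (h : IsSwitchAlong p e₀ e₁) : Nonempty (SwitchSquare d₀ d₁ e₀ e₁) := by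
  obtain ⟨P, p₀, p₁, u₀, u₁, hP, h₀, h₀', h₁, h₁', sq₀, sq₁, -⟩ := hp
  obtain ⟨⟨p', hm₀, hh₁, hm₀', hh₁'⟩, P', a₀, a₁, b₀, b₁, hP', hb₀, hb, hb₁⟩ := h
  obtain ⟨Q, c₀, c₁, v₁, v₀, hQ, k₁, -, k₀, k₀', tq₁, tq₀, -⟩ := hs p'
  have hmf : Mono e₀.f := hM.mono (e₀.f_mem hM hρ₁)
  have hmf₁ : Mono e₁.f := hM.mono (e₁.f_mem hM hρ₀)
  obtain ⟨q₀, q₁, w₀, w', w₂⟩ : ∃ (q₀ : P ⟶ e₀.D) (q₁ : P ⟶ e₁.D),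
      q₀ ≫ e₀.f = p₀ ≫ d₀.f ∧ q₀ ≫ e₀.g = q₁ ≫ e₁.f ∧ q₁ ≫ e₁.g = p₁ ≫ d₁.g := by
    refine ⟨(hP.isoIsPullback _ _ hP').hom ≫ b₀, (hP.isoIsPullback _ _ hP').hom ≫ b₁, ?_, ?_, ?_⟩
    · simp [hb₀]
    · simp [hb]
    · simp [hb₁]
  have uq₀ : u₁ ≫ q₀ = e₀.k := by
    rw [← cancel_mono e₀.f, Category.assoc, w₀, reassoc_of% h₁, ← hm₀', e₀.left.w]
  have := hM.hasPushout u₀ ρ₀.l hρ₀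
  have sqj₁ : IsPushout ρ₀.l u₀ _ _ := (IsPushout.of_hasPushout u₀ ρ₀.l).flip
  set j := pushout.inr u₀ ρ₀.l
  set q := pushout.inl u₀ ρ₀.l
  have wf : ρ₀.l ≫ d₀.m = u₀ ≫ p₀ ≫ d₀.f := by rw [reassoc_of% h₀, d₀.left.w]
  set f := sqj₁.desc d₀.m (p₀ ≫ d₀.f) wf
  have f₁ : j ≫ f = d₀.m := sqj₁.inl_desc _ _ wf
  have f₂ : q ≫ f = p₀ ≫ d₀.f := sqj₁.inr_desc _ _ wf
  have sqf : IsPushout p₀ q d₀.f f := by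
    have h : IsPushout ρ₀.l (u₀ ≫ p₀) (j ≫ f) d₀.f := by rw [h₀, f₁]; exact d₀.left
    exact (h.of_top f₂ sqj₁).flip
  -- This is a second pushout complement of `ρ₁.l` and `e₀.m`; uniqueness identifies the pushout leg
  -- `q` with `q₀`.
  have sqe : IsPushout ρ₁.l (u₁ ≫ q) e₀.m f := by rw [hm₀']; exact sq₁.paste_vert sqf
  obtain ⟨χ, -, hχ⟩ := hM.exists_iso_of_isPushout hρ₁ sqe e₀.left
  have sqj : IsPushout ρ₀.l u₀ p'.i₁ q₀ := by
    refine sqj₁.of_iso (Iso.refl _) (Iso.refl _) (Iso.refl _) χ (by simp) (by simp) ?_ ?_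
    · rw [← cancel_mono e₀.f, Category.assoc, hχ, f₁, hm₀]; simp
    · rw [← cancel_mono e₀.f, Category.assoc, hχ, f₂, ← w₀]; simp
  -- `P` and `Q` are both pushout complements of `ρ₀.l` and `p'.i₁`, so the pushout on the `ρ₁.r`
  -- side can be moved from `Q` to `P`.
  obtain ⟨θ, hθ, hθ'⟩ := hM.exists_iso_of_isPushout hρ₀ sqj tq₀
  have hθ₁ : θ.hom ≫ c₁ = q₁ := by
    rw [← cancel_mono e₁.f, Category.assoc, ← hQ.w, reassoc_of% hθ', w']
  have hc₀ : Mono c₀ := hM.mono (hM.of_isPushout tq₀.flip hρ₀)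
  have hu₁ : u₁ ≫ θ.hom = v₁ := by
    rw [← cancel_mono c₀, Category.assoc, hθ', uq₀, k₁]
  have sqj₀ : IsPushout ρ₁.r u₁ p'.i₀ q₁ :=
    isPushout_of_iso_right tq₁ θ.symm (by simp [← hu₁]) (by simp [← hθ₁])
  exact ⟨{ P := P, p₀ := p₀, p₁ := p₁, q₀ := q₀, q₁ := q₁, u₀ := u₀, u₁ := u₁
           i₀ := p.i₀, i₁ := p.i₁, j₀ := p'.i₀, j₁ := p'.i₁
           isPushout_i₀ := sq₀, isPushout_i₁ := sq₁, isPushout_j₀ := sqj₀, isPushout_j₁ := sqj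
           i₀_f := p.fac₀, i₁_g := p.fac₁, j₀_f := p'.fac₀, j₁_g := p'.fac₁
           i₀_g := hh₁'.symm, i₁_f := hm₀'.symm, j₀_g := hh₁.symm, j₁_f := hm₀.symm
           u₀_p₀ := h₀, u₁_p₁ := h₁', u₁_q₀ := uq₀
           u₀_q₁ := by rw [← hθ₁, reassoc_of% hθ, k₀']
           w₀ := w₀.symm, w := hP.w, w' := w', w₂ := w₂.symm }⟩

/-- Switches along the same independence pair are isomorphic. -/
theorem exists_isoVia (hM : IsMAdhesive M) (hρ₀ : M ρ₀.l) (hρ₁ : M ρ₁.l) {G₁'' : C}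
    {e₀' : DirectDerivation ρ₁ G₀ G₁''} {e₁' : DirectDerivation ρ₀ G₁'' G₂}
    (s : SwitchSquare d₀ d₁ e₀ e₁) (s' : SwitchSquare d₀ d₁ e₀' e₁') (hi : s.i₁ = s'.i₁) :
    ∃ θ : G₁' ≅ G₁'', e₀.IsoVia (Iso.refl G₀) θ e₀' ∧ e₁.IsoVia θ (Iso.refl G₂) e₁' := by
  have hm : e₀.m ≫ (Iso.refl G₀).hom = e₀'.m := by simp [← s.i₁_f, ← s'.i₁_f, hi]
  obtain ⟨θ, χ₀, hk, hh, hf, hg⟩ := e₀.exists_iso_of_match hM hρ₁ e₀' (Iso.refl G₀) hm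
  have hmf : Mono e₀'.f := hM.mono (e₀'.f_mem hM hρ₁)
  have hmf₁ : Mono e₁'.f := hM.mono (e₁'.f_mem hM hρ₀)
  have hmd : Mono d₁.f := hM.mono (d₁.f_mem hM hρ₁)
  have hi₀ : s.i₀ = s'.i₀ := by rw [← cancel_mono d₁.f, s.i₀_f, s'.i₀_f]
  simp only [Iso.refl_hom, Category.comp_id] at hf hm
  have hj₁ : s.j₁ ≫ χ₀.hom = s'.j₁ := by
    rw [← cancel_mono e₀'.f, Category.assoc, ← hf, s.j₁_f, s'.j₁_f]
  have hm₁ : e₁.m ≫ θ.hom = e₁'.m := by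
    rw [← s.j₁_g, Category.assoc, hg, reassoc_of% hj₁, s'.j₁_g]
  -- Of this only `χ₁` and its compatibility with `k` and `f` are kept: the component at `G₂` must
  -- be the identity, so `h` and `g` are compared anew.
  obtain ⟨ψ, χ₁, hk₁, hh₁, hf₁, hg₁⟩ := e₁.exists_iso_of_match hM hρ₀ e₁' θ hm₁
  let π := (s.isPullback_target hM hρ₁).isoIsPullback _ _ (s'.isPullback_target hM hρ₁)
  have π₀ : π.hom ≫ s'.p₀ = s.p₀ := by simp [π]
  have π₁ : π.hom ≫ s'.p₁ = s.p₁ := by simp [π]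
  have hq₀ : s.q₀ ≫ χ₀.hom = π.hom ≫ s'.q₀ := by
    rw [← cancel_mono e₀'.f, Category.assoc, Category.assoc, ← hf, ← s.w₀, ← s'.w₀,
      reassoc_of% π₀]
  have hq₁ : s.q₁ ≫ χ₁.hom = π.hom ≫ s'.q₁ := by
    rw [← cancel_mono e₁'.f, Category.assoc, Category.assoc, ← hf₁, ← s'.w', ← reassoc_of% hq₀,
      ← hg, reassoc_of% s.w']
  have hj₀ : s.j₀ ≫ χ₁.hom = s'.j₀ := by
    rw [← cancel_mono e₁'.f, Category.assoc, ← hf₁, reassoc_of% s.j₀_f, hh, s'.j₀_f]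
  refine ⟨θ, ⟨χ₀, by simpa using hm, hk, hh, by simpa using hf, hg⟩,
    ⟨χ₁, hm₁, hk₁, ?_, hf₁, ?_⟩⟩
  · simp [← s.i₀_g, ← s'.i₀_g, hi₀]
  · rw [Iso.refl_hom, Category.comp_id]
    -- `e₁.D` is glued from `ρ₁.R` and `P`; on each part both sides are determined by `d₁`.
    refine s.isPushout_j₀.hom_ext ?_ ?_
    · rw [reassoc_of% hj₀, s.j₀_g, s'.j₀_g]
    · rw [reassoc_of% hq₁, ← s.w₂, ← s'.w₂, reassoc_of% π₁]

end SwitchSquare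

/-! ### Three switches and the braid relation -/

namespace SwitchSquare

variable {M : MorphismProperty C} {ρ₀ ρ₁ ρ₂ : Rule C} {G A₀ A₁ A₂ A₀₁ A₁₂ Z : C}
  {d₀ : DirectDerivation ρ₀ G A₀} {d₁ : DirectDerivation ρ₁ A₀ A₀₁}
  {d₂ : DirectDerivation ρ₂ A₀₁ Z} {e₀ : DirectDerivation ρ₁ G A₁}
  {e₁ : DirectDerivation ρ₀ A₁ A₀₁} {f₁ : DirectDerivation ρ₂ A₁ A₁₂}
  {f₂ : DirectDerivation ρ₀ A₁₂ Z} {k₀ : DirectDerivation ρ₂ G A₂}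
  {k₁ : DirectDerivation ρ₁ A₂ A₁₂}

/-- In three successive switches that reverse the order of three steps, the part preserved by the
second switch is covered by the part `T` preserved by all steps and by the right-hand side of the
middle rule. -/
theorem exists_jointly_epi (hM : IsMAdhesive M) (hρ₀ : M ρ₀.l) (hρ₂ : M ρ₂.l)
    (s₁ : SwitchSquare d₀ d₁ e₀ e₁) (s₂ : SwitchSquare e₁ d₂ f₁ f₂)
    (s₃ : SwitchSquare e₀ f₁ k₀ k₁) (x : ρ₁.R ⟶ s₂.P) (hx : x ≫ s₂.q₀ = s₃.i₀) :
    ∃ (T : C) (α : T ⟶ s₁.P) (β : T ⟶ s₂.P) (γ : T ⟶ s₃.P),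
      α ≫ s₁.q₁ = β ≫ s₂.p₀ ∧ γ ≫ s₃.p₀ = α ≫ s₁.q₀ ∧ γ ≫ s₃.p₁ = β ≫ s₂.q₀ ∧
      ∀ {W : C} {a b : s₂.P ⟶ W}, β ≫ a = β ≫ b → x ≫ a = x ≫ b → a = b := by
  have hp₂ := s₂.p₀_mem hM hρ₂
  have hp₃ := s₃.p₀_mem hM hρ₂
  have hq₁ := s₁.q₀_mem hM hρ₀
  have := hM.hasPullback s₁.q₁ s₂.p₀ hp₂
  have sqT : IsPullback _ _ s₁.q₁ s₂.p₀ := IsPullback.of_hasPullback s₁.q₁ s₂.p₀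
  set α := pullback.fst s₁.q₁ s₂.p₀
  set β := pullback.snd s₁.q₁ s₂.p₀
  have P₂ := s₂.isPullback_source hM hρ₂
  have P₃ := s₃.isPullback_target hM hρ₂
  have hγ : (α ≫ s₁.q₀) ≫ e₀.g = (β ≫ s₂.q₀) ≫ f₁.f := by
    rw [Category.assoc, Category.assoc, s₁.w', reassoc_of% sqT.w, s₂.w₀]
  obtain ⟨γ, hγ₀, hγ₁⟩ : ∃ γ : pullback s₁.q₁ s₂.p₀ ⟶ s₃.P,
      γ ≫ s₃.p₀ = α ≫ s₁.q₀ ∧ γ ≫ s₃.p₁ = β ≫ s₂.q₀ :=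
    ⟨P₃.lift _ _ hγ, P₃.lift_fst _ _ hγ, P₃.lift_snd _ _ hγ⟩
  have sqγ : IsPullback γ α s₃.p₀ s₁.q₀ := by
    have h : IsPullback (γ ≫ s₃.p₁) α f₁.f (s₁.q₀ ≫ e₀.g) := by
      rw [hγ₁, s₁.w']
      exact sqT.flip.paste_horiz P₂.flip
    exact h.of_right hγ₀ P₃.flip
  have hα : M α := hM.of_isPullback sqT.flip hp₂
  have hγM : M γ := hM.of_isPullback sqγ.flip hq₁
  -- Over the pushout of `s₁` at `A₁`, the Van Kampen property shows that `f₁.D` is glued from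
  -- `s₂.P` and `s₃.P` along `T`.
  have cube := (hM.vanKampen s₁.q₁ s₁.q₀ e₁.f e₀.g hq₁ s₁.symm.isPushout_target).2
    β γ s₂.q₀ s₃.p₁ α s₂.p₀ s₃.p₀ f₁.f hα hp₂ hp₃ (f₁.f_mem hM hρ₂) sqT.flip sqγ
    ⟨P₂.w.symm⟩ ⟨P₃.w.symm⟩ ⟨hγ₁.symm⟩
  have top : IsPushout β γ s₂.q₀ s₃.p₁ := cube.2 ⟨P₂.flip, P₃.flip⟩
  refine ⟨_, α, β, γ, sqT.w, hγ₀, hγ₁, fun {W a b} hβ hxab => ?_⟩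
  -- To use that `f₁.D` is also glued from `ρ₁.R` and `s₃.P`, the arrows `a` and `b` must extend
  -- over `f₁.D`. They do after enlarging `W` along `ι`, which is mono because `γ` is in `M`.
  have := hM.hasPushout (β ≫ a) γ hγM
  have sqW : IsPushout (β ≫ a) γ _ _ := IsPushout.of_hasPushout (β ≫ a) γ
  set ι := pushout.inl (β ≫ a) γ
  set κ := pushout.inr (β ≫ a) γ
  have := hM.mono (hM.of_isPushout sqW hγM)
  have wa : β ≫ a ≫ ι = γ ≫ κ := by simpa using sqW.w
  have wb : β ≫ b ≫ ι = γ ≫ κ := by rw [← wa, reassoc_of% hβ]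
  have key : top.desc (a ≫ ι) κ wa = top.desc (b ≫ ι) κ wb := by
    refine s₃.isPushout_i₀.hom_ext ?_ ?_
    · rw [← hx, Category.assoc, Category.assoc, top.inl_desc, top.inl_desc, reassoc_of% hxab]
    · rw [top.inr_desc, top.inr_desc]
  rw [← cancel_mono ι, ← top.inl_desc (a ≫ ι) κ wa, key, top.inl_desc]

/-- The braid relation for switches. -/
theorem braid (hM : IsMAdhesive M) {R : Set (Rule C)} (hR : IsLeftLinear M R)
    (hW : IsStrongEnforcing R) (h₀ : ρ₀ ∈ R) (h₁ : ρ₁ ∈ R) (h₂ : ρ₂ ∈ R)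
    (s₁ : SwitchSquare d₀ d₁ e₀ e₁) (s₂ : SwitchSquare e₁ d₂ f₁ f₂)
    (s₃ : SwitchSquare e₀ f₁ k₀ k₁) :
    ∃ (A₀₂ A₂' A₁₂' : C) (a₁ : DirectDerivation ρ₂ A₀ A₀₂) (a₂ : DirectDerivation ρ₁ A₀₂ Z)
      (b₀ : DirectDerivation ρ₂ G A₂') (b₁ : DirectDerivation ρ₀ A₂' A₀₂)
      (c₁ : DirectDerivation ρ₁ A₂' A₁₂') (c₂ : DirectDerivation ρ₀ A₁₂' Z),
      Nonempty (SwitchSquare d₁ d₂ a₁ a₂) ∧ Nonempty (SwitchSquare d₀ a₁ b₀ b₁) ∧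
      Nonempty (SwitchSquare b₁ a₂ c₁ c₂) ∧
      ∃ (ψ₂ : A₂ ≅ A₂') (ψ₁₂ : A₁₂ ≅ A₁₂'), k₀.IsoVia (Iso.refl G) ψ₂ b₀ ∧
        k₁.IsoVia ψ₂ ψ₁₂ c₁ ∧ f₂.IsoVia ψ₁₂ (Iso.refl Z) c₂ := by
  have l₀ := hR _ h₀
  have l₁ := hR _ h₁
  have l₂ := hR _ h₂
  -- The arrows `x`, `y`, `z`, `t` lift left- and right-hand sides of the rules to parts preserved
  -- by two steps. From them come the independence pairs of the other three switches.
  have hx : s₁.j₀ ≫ e₁.f = s₃.i₀ ≫ f₁.f := by rw [s₁.j₀_f, s₃.i₀_f]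
  obtain ⟨x, x₀, x₁⟩ : ∃ x : ρ₁.R ⟶ s₂.P, x ≫ s₂.p₀ = s₁.j₀ ∧ x ≫ s₂.q₀ = s₃.i₀ :=
    ⟨_, (s₂.isPullback_source hM l₂).lift_fst _ _ hx,
      (s₂.isPullback_source hM l₂).lift_snd _ _ hx⟩
  have hy : s₃.i₁ ≫ e₀.g = s₂.i₁ ≫ e₁.f := by rw [s₃.i₁_g, s₂.i₁_f]
  obtain ⟨y, y₀, y₁⟩ : ∃ y : ρ₂.L ⟶ s₁.P, y ≫ s₁.q₀ = s₃.i₁ ∧ y ≫ s₁.q₁ = s₂.i₁ :=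
    ⟨_, (s₁.symm.isPullback_target hM l₀).lift_fst _ _ hy,
      (s₁.symm.isPullback_target hM l₀).lift_snd _ _ hy⟩
  let p₄ : IndependencePair d₁ d₂ :=
    { i₀ := x ≫ s₂.p₁
      i₁ := y ≫ s₁.p₁
      fac₀ := by rw [Category.assoc, ← s₂.w, reassoc_of% x₀, s₁.j₀_g]
      fac₁ := by rw [Category.assoc, s₁.w₂, reassoc_of% y₁, s₂.i₁_g] }
  obtain ⟨A₀₂, a₁, a₂, s₄, i₄₀, i₄₁⟩ := exists_of_isStrong hM l₁ p₄ (hW h₁ h₂ _ _ _)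
  have hz : s₁.i₀ ≫ d₁.g = s₂.i₀ ≫ d₂.f := by rw [s₁.i₀_g, s₂.i₀_f]
  obtain ⟨z, z₀, z₁⟩ : ∃ z : ρ₀.R ⟶ s₄.P, z ≫ s₄.p₀ = s₁.i₀ ∧ z ≫ s₄.p₁ = s₂.i₀ :=
    ⟨_, (s₄.isPullback_target hM l₂).lift_fst _ _ hz,
      (s₄.isPullback_target hM l₂).lift_snd _ _ hz⟩
  let p₅ : IndependencePair d₀ a₁ :=
    { i₀ := z ≫ s₄.q₀
      i₁ := y ≫ s₁.p₀
      fac₀ := by rw [Category.assoc, ← s₄.w₀, reassoc_of% z₀, s₁.i₀_f]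
      fac₁ := by rw [Category.assoc, s₁.w, ← s₄.i₁_f, i₄₁, Category.assoc] }
  obtain ⟨A₂', b₀, b₁, s₅, i₅₀, i₅₁⟩ := exists_of_isStrong hM l₀ p₅ (hW h₀ h₂ _ _ _)
  have ht : s₁.i₁ ≫ d₀.g = s₄.j₁ ≫ a₁.f := by rw [s₁.i₁_g, s₄.j₁_f]
  obtain ⟨t, t₀, t₁⟩ : ∃ t : ρ₁.L ⟶ s₅.P, t ≫ s₅.p₀ = s₁.i₁ ∧ t ≫ s₅.p₁ = s₄.j₁ :=
    ⟨_, (s₅.isPullback_target hM l₂).lift_fst _ _ ht,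
      (s₅.isPullback_target hM l₂).lift_snd _ _ ht⟩
  let p₆ : IndependencePair b₁ a₂ :=
    { i₀ := z ≫ s₄.q₁
      i₁ := t ≫ s₅.q₁
      fac₀ := by rw [Category.assoc, ← s₄.w', ← s₅.i₀_g, i₅₀, Category.assoc]
      fac₁ := by rw [Category.assoc, ← s₅.w₂, reassoc_of% t₁, s₄.j₁_g] }
  obtain ⟨A₁₂', c₁, c₂, s₆, i₆₀, i₆₁⟩ := exists_of_isStrong hM l₀ p₆ (hW h₀ h₁ _ _ _)
  refine ⟨A₀₂, A₂', A₁₂', a₁, a₂, b₀, b₁, c₁, c₂, ⟨s₄⟩, ⟨s₅⟩, ⟨s₆⟩, ?_⟩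
  have := hM.mono (b₀.f_mem hM l₂)
  have := hM.mono (c₁.f_mem hM l₁)
  have := hM.mono (c₂.f_mem hM l₀)
  -- the first steps agree
  have m₂ : k₀.m ≫ (Iso.refl G).hom = b₀.m := by
    rw [Iso.refl_hom, Category.comp_id, ← s₃.i₁_f, ← s₅.i₁_f, i₅₁, Category.assoc, s₁.w₀,
      reassoc_of% y₀]
  obtain ⟨ψ₂, χ₀, kk₀, kh₀, kf₀, kg₀⟩ :=
    k₀.exists_iso_of_match hM l₂ b₀ (Iso.refl G) m₂
  have kf₀' : χ₀.hom ≫ b₀.f = k₀.f := by rw [← kf₀, Iso.refl_hom, Category.comp_id]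
  -- the second steps agree
  have m₁ : k₁.m ≫ ψ₂.hom = c₁.m := by
    have h : s₃.j₁ ≫ χ₀.hom = t ≫ s₅.q₀ := by
      rw [← cancel_mono b₀.f, Category.assoc, Category.assoc, kf₀', s₃.j₁_f, ← s₅.w₀,
        reassoc_of% t₀, s₁.i₁_f]
    rw [← s₃.j₁_g, ← s₆.i₁_f, i₆₁, Category.assoc, Category.assoc, ← s₅.w', ← reassoc_of% h, kg₀]
  obtain ⟨ψ₁₂, χ₁, kk₁, kh₁, kf₁, kg₁⟩ := k₁.exists_iso_of_match hM l₁ c₁ ψ₂ m₁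
  -- the third steps agree
  have m₀ : f₂.m ≫ ψ₁₂.hom = c₂.m := by
    have hw : s₁.j₁ ≫ e₀.g = s₂.j₁ ≫ f₁.f := by rw [s₁.j₁_g, s₂.j₁_f]
    obtain ⟨w, w₀, w₁⟩ : ∃ w : ρ₀.L ⟶ s₃.P, w ≫ s₃.p₀ = s₁.j₁ ∧ w ≫ s₃.p₁ = s₂.j₁ :=
      ⟨_, (s₃.isPullback_target hM l₂).lift_fst _ _ hw,
        (s₃.isPullback_target hM l₂).lift_snd _ _ hw⟩
    have h : w ≫ s₃.q₀ ≫ χ₀.hom = s₅.j₁ := by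
      rw [← cancel_mono b₀.f, Category.assoc, Category.assoc, kf₀', ← s₃.w₀, reassoc_of% w₀,
        s₁.j₁_f, s₅.j₁_f]
    have h' : w ≫ s₃.q₁ ≫ χ₁.hom = s₆.j₁ := by
      rw [← cancel_mono c₁.f, Category.assoc, Category.assoc, ← kf₁, ← reassoc_of% s₃.w', kg₀,
        reassoc_of% h, s₅.j₁_g, s₆.j₁_f]
    rw [← s₂.j₁_g, ← w₁, Category.assoc, Category.assoc, reassoc_of% s₃.w₂, kg₁, reassoc_of% h',
      s₆.j₁_g]
  obtain ⟨ψ, χ₂, kk₂, kh₂, kf₂, kg₂⟩ := f₂.exists_iso_of_match hM l₀ c₂ ψ₁₂ m₀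
  refine ⟨ψ₂, ψ₁₂, ⟨χ₀, m₂, kk₀, kh₀, kf₀, kg₀⟩, ⟨χ₁, m₁, kk₁, kh₁, kf₁, kg₁⟩,
    ⟨χ₂, m₀, kk₂, ?_, kf₂, ?_⟩⟩
  · rw [Iso.refl_hom, Category.comp_id, ← s₂.i₀_g, ← s₆.i₀_g, i₆₀, Category.assoc, ← s₄.w₂,
      reassoc_of% z₁]
  -- What remains is an equation of arrows out of `f₂.D`, which is glued from `ρ₂.R` and `s₂.P`; on
  -- the latter it is tested on `T` and on `ρ₁.R`.
  rw [Iso.refl_hom, Category.comp_id]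
  refine s₂.isPushout_j₀.hom_ext ?_ ?_
  · have hv : s₅.j₀ ≫ b₁.g = s₄.j₀ ≫ a₂.f := by rw [s₅.j₀_g, s₄.j₀_f]
    obtain ⟨v, v₀, v₁⟩ : ∃ v : ρ₂.R ⟶ s₆.P, v ≫ s₆.p₀ = s₅.j₀ ∧ v ≫ s₆.p₁ = s₄.j₀ :=
      ⟨_, (s₆.isPullback_target hM l₁).lift_fst _ _ hv,
        (s₆.isPullback_target hM l₁).lift_snd _ _ hv⟩
    have h : s₃.j₀ ≫ χ₁.hom = v ≫ s₆.q₀ := by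
      rw [← cancel_mono c₁.f, Category.assoc, Category.assoc, ← kf₁, reassoc_of% s₃.j₀_f, kh₀,
        ← s₆.w₀, reassoc_of% v₀, s₅.j₀_f]
    have h' : s₂.j₀ ≫ χ₂.hom = v ≫ s₆.q₁ := by
      rw [← cancel_mono c₂.f, Category.assoc, Category.assoc, ← kf₂, reassoc_of% s₂.j₀_f,
        ← reassoc_of% s₃.j₀_g, kg₁, reassoc_of% h, s₆.w']
    rw [reassoc_of% h', ← s₆.w₂, reassoc_of% v₁, s₄.j₀_g, s₂.j₀_g]
  obtain ⟨T, α, β, γ, hαβ, hγ₀, hγ₁, hT⟩ := exists_jointly_epi hM l₀ l₂ s₁ s₂ s₃ x x₁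
  refine hT ?_ ?_
  · have hδ : (α ≫ s₁.p₁) ≫ d₁.g = (β ≫ s₂.p₁) ≫ d₂.f := by
      rw [Category.assoc, Category.assoc, s₁.w₂, reassoc_of% hαβ, s₂.w]
    obtain ⟨δ, δ₀, δ₁⟩ : ∃ δ : T ⟶ s₄.P, δ ≫ s₄.p₀ = α ≫ s₁.p₁ ∧ δ ≫ s₄.p₁ = β ≫ s₂.p₁ :=
      ⟨_, (s₄.isPullback_target hM l₂).lift_fst _ _ hδ,
        (s₄.isPullback_target hM l₂).lift_snd _ _ hδ⟩
    have hε : (α ≫ s₁.p₀) ≫ d₀.g = (δ ≫ s₄.q₀) ≫ a₁.f := by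
      rw [Category.assoc, Category.assoc, s₁.w, ← s₄.w₀, reassoc_of% δ₀]
    obtain ⟨ε, ε₀, ε₁⟩ : ∃ ε : T ⟶ s₅.P, ε ≫ s₅.p₀ = α ≫ s₁.p₀ ∧ ε ≫ s₅.p₁ = δ ≫ s₄.q₀ :=
      ⟨_, (s₅.isPullback_target hM l₂).lift_fst _ _ hε,
        (s₅.isPullback_target hM l₂).lift_snd _ _ hε⟩
    have hζ : (ε ≫ s₅.q₁) ≫ b₁.g = (δ ≫ s₄.q₁) ≫ a₂.f := by
      rw [Category.assoc, Category.assoc, ← s₅.w₂, reassoc_of% ε₁, s₄.w']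
    obtain ⟨ζ, ζ₀, ζ₁⟩ : ∃ ζ : T ⟶ s₆.P, ζ ≫ s₆.p₀ = ε ≫ s₅.q₁ ∧ ζ ≫ s₆.p₁ = δ ≫ s₄.q₁ :=
      ⟨_, (s₆.isPullback_target hM l₁).lift_fst _ _ hζ,
        (s₆.isPullback_target hM l₁).lift_snd _ _ hζ⟩
    have h : γ ≫ s₃.q₀ ≫ χ₀.hom = ε ≫ s₅.q₀ := by
      rw [← cancel_mono b₀.f, Category.assoc, Category.assoc, Category.assoc, kf₀', ← s₃.w₀,
        reassoc_of% hγ₀, ← s₁.w₀, ← s₅.w₀, reassoc_of% ε₀]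
    have h' : γ ≫ s₃.q₁ ≫ χ₁.hom = ζ ≫ s₆.q₀ := by
      rw [← cancel_mono c₁.f, Category.assoc, Category.assoc, Category.assoc, ← kf₁,
        ← reassoc_of% s₃.w', kg₀, reassoc_of% h, ← s₆.w₀, reassoc_of% ζ₀, s₅.w']
    have h'' : β ≫ s₂.q₁ ≫ χ₂.hom = ζ ≫ s₆.q₁ := by
      rw [← cancel_mono c₂.f, Category.assoc, Category.assoc, Category.assoc, ← kf₂,
        ← reassoc_of% s₂.w', ← reassoc_of% hγ₁, reassoc_of% s₃.w₂, kg₁, reassoc_of% h', s₆.w']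
    rw [reassoc_of% h'', ← s₆.w₂, reassoc_of% ζ₁, ← s₄.w₂, reassoc_of% δ₁, s₂.w₂]
  · have h : x ≫ s₂.q₁ ≫ χ₂.hom = s₆.j₀ := by
      rw [← cancel_mono c₂.f, Category.assoc, Category.assoc, ← kf₂, ← reassoc_of% s₂.w',
        reassoc_of% x₁, reassoc_of% s₃.i₀_g, kh₁, s₆.j₀_f]
    rw [reassoc_of% h, s₆.j₀_g, ← s₂.w₂, ← s₄.i₀_g, i₄₀, Category.assoc]

end SwitchSquare

end DPO

namespace DPO

/-! ### Reduction of words in adjacent transpositions -/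

/-- Reduction of words by cancellation, commutation of distant letters, and the braid relation
read from left to right. -/
inductive WordReduces : List ℕ → List ℕ → Prop
  | refl (w : List ℕ) : WordReduces w w
  | trans {w₁ w₂ w₃ : List ℕ} : WordReduces w₁ w₂ → WordReduces w₂ w₃ → WordReduces w₁ w₃
  | context (x y : List ℕ) {w₁ w₂ : List ℕ} :
      WordReduces w₁ w₂ → WordReduces (x ++ w₁ ++ y) (x ++ w₂ ++ y)
  | cancel (i : ℕ) : WordReduces [i, i] []
  | comm_lt {i j : ℕ} : i + 1 < j → WordReduces [i, j] [j, i]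
  | comm_gt {i j : ℕ} : j + 1 < i → WordReduces [i, j] [j, i]
  | braid (i : ℕ) : WordReduces [i, i + 1, i] [i + 1, i, i + 1]

namespace WordReduces

theorem append_left (x : List ℕ) {w₁ w₂ : List ℕ} (h : WordReduces w₁ w₂) :
    WordReduces (x ++ w₁) (x ++ w₂) := by
  simpa using h.context x []

theorem append_right (y : List ℕ) {w₁ w₂ : List ℕ} (h : WordReduces w₁ w₂) :
    WordReduces (w₁ ++ y) (w₂ ++ y) := by
  simpa using h.context [] y

theorem cons (i : ℕ) {w₁ w₂ : List ℕ} (h : WordReduces w₁ w₂) :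
    WordReduces (i :: w₁) (i :: w₂) :=
  h.append_left [i]

theorem comm {i j : ℕ} (h : i + 1 < j ∨ j + 1 < i) : WordReduces [i, j] [j, i] :=
  h.elim comm_lt comm_gt

theorem cons_comm (i : ℕ) (u : List ℕ) (h : ∀ j ∈ u, i + 1 < j ∨ j + 1 < i) :
    WordReduces (i :: u) (u ++ [i]) := by
  induction u with
  | nil => exact refl _
  | cons j u ih =>
    have h₁ : WordReduces (i :: j :: u) (j :: i :: u) :=
      (comm (h j (by simp))).append_right u
    exact h₁.trans ((ih fun k hk => h k (by simp [hk])).cons j)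

theorem comm_cons (i : ℕ) (u : List ℕ) (h : ∀ j ∈ u, i + 1 < j ∨ j + 1 < i) :
    WordReduces (u ++ [i]) (i :: u) := by
  induction u with
  | nil => exact refl _
  | cons j u ih =>
    have h₁ : WordReduces (j :: i :: u) (i :: j :: u) :=
      (comm (h j (by simp)).symm).append_right u
    exact ((ih fun k hk => h k (by simp [hk])).cons j).trans h₁

theorem append_comm (u v : List ℕ) (h : ∀ i ∈ u, ∀ j ∈ v, i + 1 < j ∨ j + 1 < i) :
    WordReduces (u ++ v) (v ++ u) := by
  induction u with
  | nil => simpa using refl v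
  | cons i u ih =>
    have h₁ := (ih fun k hk => h k (by simp [hk])).cons i
    have h₂ := (cons_comm i v (h i (by simp))).append_right u
    simpa using h₁.trans h₂

/-- A letter passes an ascending run. -/
theorem Ico_append_letter {a b j : ℕ} (ha : a ≤ j) (hb : j + 1 < b) :
    WordReduces (List.Ico a b ++ [j]) ((j + 1) :: List.Ico a b) := by
  have e : List.Ico a b = List.Ico a j ++ [j, j + 1] ++ List.Ico (j + 2) b := by
    rw [← List.Ico.append_consecutive ha (by omega : j ≤ b),
      List.Ico.eq_cons (by omega : j < b), List.Ico.eq_cons hb]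
    simp
  have h₁ : WordReduces (List.Ico a b ++ [j])
      (List.Ico a j ++ [j, j + 1] ++ ([j] ++ List.Ico (j + 2) b)) := by
    rw [e]
    have := (comm_cons j (List.Ico (j + 2) b) fun k hk => by
      rw [List.Ico.mem] at hk; omega).append_left (List.Ico a j ++ [j, j + 1])
    simpa using this
  have h₂ : WordReduces (List.Ico a j ++ [j, j + 1] ++ ([j] ++ List.Ico (j + 2) b))
      (List.Ico a j ++ [j + 1] ++ ([j, j + 1] ++ List.Ico (j + 2) b)) := by
    simpa using (braid j).context (List.Ico a j) (List.Ico (j + 2) b)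
  have h₃ := (comm_cons (j + 1) (List.Ico a j) fun k hk => by
      rw [List.Ico.mem] at hk; omega).append_right ([j, j + 1] ++ List.Ico (j + 2) b)
  refine (h₁.trans h₂).trans (h₃.trans ?_)
  rw [e]
  simpa using refl _

/-- An ascending run passes a longer one. -/
theorem Ico_append_Ico_of_lt {a b c d : ℕ} (ha : a ≤ c) (hd : d < b) :
    WordReduces (List.Ico a b ++ List.Ico c d) (List.Ico (c + 1) (d + 1) ++ List.Ico a b) := by
  induction d with
  | zero => simpa [List.Ico.eq_nil_of_le] using refl _
  | succ d ih =>
    rcases Nat.lt_or_ge d c with h | h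
    · rw [List.Ico.eq_nil_of_le (by omega : d + 1 ≤ c),
        List.Ico.eq_nil_of_le (by omega : d + 1 + 1 ≤ c + 1)]
      simpa using refl _
    · rw [List.Ico.succ_top h, List.Ico.succ_top (by omega : c + 1 ≤ d + 1)]
      -- The last letter `d` of the short run crosses the long one and emerges as `d + 1`,
      -- prolonging the shifted run.
      have h₁ := (ih (by omega)).append_right [d]
      have h₂ := (Ico_append_letter (ha.trans h) hd).append_left (List.Ico (c + 1) (d + 1))
      simpa using h₁.trans (by simpa using h₂)

/-- An ascending run followed by a run that is at least as long and has the same start. -/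
theorem Ico_append_Ico_of_ge {a b c : ℕ} (ha : a < b) (hc : b ≤ c) :
    WordReduces (List.Ico a b ++ List.Ico a c)
      (List.Ico (a + 1) c ++ List.Ico a (b - 1)) := by
  obtain ⟨b, rfl⟩ : ∃ k, b = k + 1 := ⟨b - 1, by omega⟩
  -- After the first run has crossed the initial part of the second, its last letter `b` meets the
  -- letter `b` and cancels.
  have e : List.Ico a c = List.Ico a b ++ (b :: List.Ico (b + 1) c) := by
    rw [← List.Ico.eq_cons (by omega), List.Ico.append_consecutive (by omega) (by omega)]
  have h₁ := (Ico_append_Ico_of_lt (a := a) (b := b + 1) le_rfl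
    (Nat.lt_succ_self b)).append_right (b :: List.Ico (b + 1) c)
  have h₂ : WordReduces (List.Ico (a + 1) (b + 1) ++ List.Ico a (b + 1) ++
      (b :: List.Ico (b + 1) c)) (List.Ico (a + 1) (b + 1) ++ List.Ico a b ++
        List.Ico (b + 1) c) := by
    rw [List.Ico.succ_top (by omega : a ≤ b)]
    simpa using (cancel b).context (List.Ico (a + 1) (b + 1) ++ List.Ico a b)
      (List.Ico (b + 1) c)
  have h₃ := (append_comm (List.Ico a b) (List.Ico (b + 1) c) fun i hi j hj => by
    rw [List.Ico.mem] at hi hj; omega).append_left (List.Ico (a + 1) (b + 1))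
  rw [e]
  have h₄ := h₁.trans (h₂.trans (by simpa using h₃))
  rw [← List.append_assoc, List.Ico.append_consecutive (by omega) hc] at h₄
  simpa using h₄

/-- The smallest letter of a word can be collected in a single ascending run at the end. -/
theorem exists_append_Ico (N n a : ℕ) (hn : a + n = N) (w : List ℕ)
    (hw : ∀ i ∈ w, a ≤ i ∧ i < N) :
    ∃ u b, (∀ i ∈ u, a + 1 ≤ i ∧ i < N) ∧ a ≤ b ∧ b ≤ N ∧
      WordReduces w (u ++ List.Ico a b) := by
  induction n generalizing a w with
  | zero =>
    cases w with
    | nil => exact ⟨[], a, by simp, le_rfl, by omega, by simpa using refl _⟩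
    | cons i w => have := hw i (by simp); omega
  | succ n ihn =>
    induction w with
    | nil => exact ⟨[], a, by simp, le_rfl, by omega, by simpa using refl _⟩
    | cons i w ihw =>
      obtain ⟨u, b, hu, hab, hb, h⟩ := ihw fun k hk => hw k (by simp [hk])
      have hi := hw i (by simp)
      rcases hi.1.lt_or_eq with hai | rfl
      · exact ⟨i :: u, b, by simpa [Nat.succ_le_iff, hai, hi.2] using hu, hab, hb, h.cons i⟩
      -- The outer induction isolates the letters `a + 1` of `u` in one run. The new `a` commutes
      -- with `u'` and heads that run, leaving two runs that start at `a`.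
      · obtain ⟨u', b', hu', hab', hb', h'⟩ := ihn (a + 1) (by omega) u hu
        have h₁ : WordReduces (a :: w) (u' ++ (List.Ico a b' ++ List.Ico a b)) := by
          refine (h.cons a).trans (((h'.append_right _).cons a).trans ?_)
          have := (cons_comm a u' fun k hk => by have := hu' k hk; omega).append_right
            (List.Ico (a + 1) b' ++ List.Ico a b)
          rw [List.Ico.eq_cons (by omega : a < b')]
          simpa using this
        rcases Nat.lt_or_ge b b' with hbb | hbb
        · refine ⟨u' ++ List.Ico (a + 1) (b + 1), b', ?_, by omega, hb', h₁.trans ?_⟩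
          · intro k hk
            rcases List.mem_append.1 hk with hk | hk
            · have := hu' k hk; omega
            · rw [List.Ico.mem] at hk; omega
          · simpa using (Ico_append_Ico_of_lt le_rfl hbb).append_left u'
        · refine ⟨u' ++ List.Ico (a + 1) b, b' - 1, ?_, by omega, by omega, h₁.trans ?_⟩
          · intro k hk
            rcases List.mem_append.1 hk with hk | hk
            · have := hu' k hk; omega
            · rw [List.Ico.mem] at hk; omega
          · simpa using (Ico_append_Ico_of_ge (by omega : a < b') hbb).append_left u'

end WordReduces

/-! ### Composites, and existence and uniqueness of canonical words -/

theorem composite_append (u v : List ℕ) : composite (u ++ v) = composite v * composite u := by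
  induction u with
  | nil => simp [composite]
  | cons i u ih => simp [composite, ih, mul_assoc]

theorem WordReduces.composite_eq {w w' : List ℕ} (h : WordReduces w w') :
    composite w = composite w' := by
  induction h with
  | refl => rfl
  | trans _ _ h₁ h₂ => exact h₁.trans h₂
  | context x y _ h => simp [composite_append, h]
  | cancel i => simp [composite]
  | comm_lt h =>
    simp only [composite, one_mul]
    refine (Equiv.Perm.Disjoint.commute ?_).eq
    intro x
    simp only [Equiv.swap_apply_def]
    grind
  | comm_gt h =>
    simp only [composite, one_mul]
    refine (Equiv.Perm.Disjoint.commute ?_).eq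
    intro x
    simp only [Equiv.swap_apply_def]
    grind
  | braid i =>
    ext x
    simp only [composite, one_mul, Equiv.Perm.mul_apply, Equiv.swap_apply_def]
    grind

/-- The letters of an ascending run carry one point upwards; each point it passes drops by one. -/
theorem composite_Ico_apply {a b : ℕ} (h : a ≤ b) (j : ℕ) :
    composite (List.Ico a b) j =
      if j < a then j else if j = a then b else if j ≤ b then j - 1 else j := by
  obtain ⟨n, rfl⟩ := Nat.exists_eq_add_of_le h
  induction n generalizing a j with
  | zero => simp [composite]; grind
  | succ n ih =>
    rw [List.Ico.eq_cons (by omega)]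
    simp only [composite, Equiv.Perm.mul_apply]
    have := ih (a := a + 1) (Equiv.swap a (a + 1) j) (by omega)
    rw [show a + 1 + n = a + (n + 1) by omega] at this
    rw [this]
    simp only [Equiv.swap_apply_def]
    grind

/-- Every word reduces to a word whose letters are, each in turn, the greatest descents of the
composite of the remaining word with any permutation that is monotone from `a` on. -/
theorem WordReduces.exists_canonical_from (N n a : ℕ) (hn : a + n = N) (w : List ℕ)
    (hw : ∀ i ∈ w, a ≤ i ∧ i < N) :
    ∃ w', WordReduces w w' ∧ ∀ τ : Equiv.Perm ℕ, StrictMonoOn τ (Set.Ici a) →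
      ∀ (k : ℕ) (hk : k < w'.length),
        IsGreatest {j : ℕ | (j, j + 1) ∈ inversions (τ * composite (w'.drop k))} w'[k] := by
  induction n generalizing a w with
  | zero =>
    cases w with
    | nil => exact ⟨[], refl _, by simp⟩
    | cons i w => have := hw i (by simp); omega
  | succ n ih =>
    obtain ⟨u, b, hu, hab, hb, h⟩ := exists_append_Ico N (n + 1) a hn w hw
    obtain ⟨u', hu', hc⟩ := ih (a + 1) (by omega) u hu
    refine ⟨u' ++ List.Ico a b, h.trans (hu'.append_right _), fun τ hτ k hk => ?_⟩
    have val (c : ℕ) (hc : a ≤ c) (hcb : c ≤ b) (j : ℕ) :=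
      congrArg τ (composite_Ico_apply hcb j)
    rcases Nat.lt_or_ge k u'.length with hku | hku
    · rw [List.getElem_append_left hku, List.drop_append_of_le_length hku.le, composite_append,
        ← mul_assoc]
      -- For a suffix starting in `u'`, the final run is absorbed into `τ`: it takes only `a` out of
      -- order, so the product is monotone from `a + 1` on.
      refine hc _ (fun x hx y hy hxy => ?_) k hku
      simp only [Set.mem_Ici] at hx hy
      simp only [Equiv.Perm.mul_apply, val a le_rfl hab]
      refine hτ (Set.mem_Ici.2 ?_) (Set.mem_Ici.2 ?_) ?_ <;> grind
    · obtain ⟨l, rfl⟩ := Nat.exists_eq_add_of_le hku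
      have hl : a + l < b := by simp at hk; omega
      have e : (u' ++ List.Ico a b).drop (u'.length + l) = List.Ico (a + l) b := by
        rw [List.drop_append, List.drop_eq_nil_of_le (by omega)]
        simp only [List.nil_append, Nat.add_sub_cancel_left]
        rw [← List.Ico.append_consecutive (by omega : a ≤ a + l) hl.le,
          List.drop_append_of_le_length (by simp)]
        simp
      have e' : (u' ++ List.Ico a b)[u'.length + l] = a + l := by
        rw [List.getElem_append_right (by omega)]
        simp [List.Ico]
      rw [e, e']
      -- The run from `a + l` sends `a + l` to `b` and shifts the points after it down, so from
      -- there on its only descent is at `a + l`. All values involved are at least `a`, where `τ` is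
      -- monotone.
      constructor
      · refine ⟨by simp, ?_⟩
        simp only [Equiv.Perm.mul_apply, val (a + l) (by omega) hl.le]
        refine hτ (Set.mem_Ici.2 ?_) (Set.mem_Ici.2 ?_) ?_ <;> grind
      · rintro j ⟨-, hj⟩
        by_contra hlt
        push Not at hlt
        refine absurd hj (not_lt.2 (le_of_lt ?_))
        simp only [Equiv.Perm.mul_apply, val (a + l) (by omega) hl.le]
        refine hτ (Set.mem_Ici.2 ?_) (Set.mem_Ici.2 ?_) ?_ <;> grind

theorem WordReduces.exists_isCanonical (w : List ℕ) : ∃ w', WordReduces w w' ∧ IsCanonical w' := by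
  obtain ⟨N, hN⟩ : ∃ N, ∀ i ∈ w, i < N :=
    ⟨w.sum + 1, fun i hi => Nat.lt_succ_of_le (List.le_sum_of_mem hi)⟩
  obtain ⟨w', h, hc⟩ := exists_canonical_from N N 0 (by simp) w fun i hi => ⟨Nat.zero_le i, hN i hi⟩
  exact ⟨w', h, fun k hk => by simpa using hc 1 (fun x _ y _ hxy => by simpa using hxy) k hk⟩

theorem IsCanonical.tail {i : ℕ} {w : List ℕ} (h : IsCanonical (i :: w)) : IsCanonical w :=
  fun k hk => h (k + 1) (by simpa using hk)

theorem IsCanonical.isGreatest {i : ℕ} {w : List ℕ} (h : IsCanonical (i :: w)) :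
    IsGreatest {j : ℕ | (j, j + 1) ∈ inversions (composite (i :: w))} i := by
  exact h 0 (by simp)

theorem IsCanonical.composite_cons_ne_one {i : ℕ} {w : List ℕ} (h : IsCanonical (i :: w)) :
    composite (i :: w) ≠ 1 := by
  intro e
  have := h.isGreatest.1
  rw [e] at this
  simp [inversions] at this

theorem IsCanonical.ext {w w' : List ℕ} (h : IsCanonical w) (h' : IsCanonical w')
    (e : composite w = composite w') : w = w' := by
  induction w generalizing w' with
  | nil =>
    cases w' with
    | nil => rfl
    | cons i w' => exact absurd e.symm h'.composite_cons_ne_one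
  | cons i w ih =>
    cases w' with
    | nil => exact absurd e h.composite_cons_ne_one
    | cons j w' =>
      have hg := h.isGreatest
      rw [e] at hg
      obtain rfl := hg.unique h'.isGreatest
      rw [ih h.tail h'.tail (mul_right_cancel e)]

end DPO

namespace DPO

variable {C : Type u} [Category.{v} C]

/-! ### Isomorphisms of derivations -/

namespace DirectDerivation

variable {ρ : Rule C} {G H G' H' G'' H'' : C}

/-- Transport of a direct derivation along isomorphisms of source and target. -/
def ofIsos (d : DirectDerivation ρ G H) (φ : G ≅ G') (ψ : H ≅ H') : DirectDerivation ρ G' H' where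
  D := d.D
  m := d.m ≫ φ.hom
  k := d.k
  h := d.h ≫ ψ.hom
  f := d.f ≫ φ.hom
  g := d.g ≫ ψ.hom
  left := d.left.of_iso (Iso.refl _) (Iso.refl _) (Iso.refl _) φ (by simp) (by simp) (by simp)
    (by simp)
  right := d.right.of_iso (Iso.refl _) (Iso.refl _) (Iso.refl _) ψ (by simp) (by simp) (by simp)
    (by simp)

theorem isoVia_ofIsos (d : DirectDerivation ρ G H) (φ : G ≅ G') (ψ : H ≅ H') :
    d.IsoVia φ ψ (d.ofIsos φ ψ) :=
  ⟨Iso.refl _, by simp [ofIsos]⟩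

theorem IsoVia.refl (d : DirectDerivation ρ G H) : d.IsoVia (Iso.refl G) (Iso.refl H) d :=
  ⟨Iso.refl _, by simp⟩

theorem IsoVia.symm {d : DirectDerivation ρ G H} {d' : DirectDerivation ρ G' H'} {φ : G ≅ G'}
    {ψ : H ≅ H'} (h : d.IsoVia φ ψ d') : d'.IsoVia φ.symm ψ.symm d := by
  obtain ⟨χ, hm, hk, hh, hf, hg⟩ := h
  refine ⟨χ.symm, ?_, ?_, ?_, ?_, ?_⟩
  · simp [← hm]
  · simp [← hk]
  · simp [← hh]
  · rw [Iso.symm_hom, Iso.symm_hom, Iso.eq_inv_comp, ← reassoc_of% hf]; simp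
  · rw [Iso.symm_hom, Iso.symm_hom, Iso.eq_inv_comp, ← reassoc_of% hg]; simp

theorem IsoVia.trans {d : DirectDerivation ρ G H} {d' : DirectDerivation ρ G' H'}
    {d'' : DirectDerivation ρ G'' H''} {φ : G ≅ G'} {ψ : H ≅ H'} {φ' : G' ≅ G''} {ψ' : H' ≅ H''}
    (h : d.IsoVia φ ψ d') (h' : d'.IsoVia φ' ψ' d'') : d.IsoVia (φ ≪≫ φ') (ψ ≪≫ ψ') d'' := by
  obtain ⟨χ, hm, hk, hh, hf, hg⟩ := h
  obtain ⟨χ', hm', hk', hh', hf', hg'⟩ := h'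
  refine ⟨χ ≪≫ χ', ?_, ?_, ?_, ?_, ?_⟩
  · simp [reassoc_of% hm, hm']
  · simp [reassoc_of% hk, hk']
  · simp [reassoc_of% hh, hh']
  · simp [reassoc_of% hf, hf']
  · simp [reassoc_of% hg, hg']

end DirectDerivation

namespace AbsEquivVia

variable {R : Set (Rule C)}

theorem refl {G H : C} (D : Derivation R G H) : AbsEquivVia (Iso.refl G) D D := by
  induction D with
  | nil G => exact .nil _
  | cons hρ d t ih => exact .cons hρ _ _ d d t t (.refl d) ih

theorem symm {G H G' H' : C} {φ : G ≅ G'} {D : Derivation R G H} {D' : Derivation R G' H'}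
    (h : AbsEquivVia φ D D') : AbsEquivVia φ.symm D' D := by
  induction h with
  | nil φ => exact .nil _
  | cons hρ φ ψ d d' t t' hd _ ih => exact .cons hρ _ _ _ _ _ _ hd.symm ih

theorem trans {G H G' H' G'' H'' : C} {φ : G ≅ G'} {φ' : G' ≅ G''} {D : Derivation R G H}
    {D' : Derivation R G' H'} {D'' : Derivation R G'' H''} (h : AbsEquivVia φ D D')
    (h' : AbsEquivVia φ' D' D'') : AbsEquivVia (φ ≪≫ φ') D D'' := by
  induction h generalizing G'' H'' with
  | nil φ => cases h'; exact .nil _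
  | cons hρ φ ψ d d' t t' hd _ ih =>
    cases h' with
    | cons _ _ ψ' _ d'' _ t'' hd' ht' => exact .cons hρ _ _ _ _ _ _ (hd.trans hd') (ih ht')

end AbsEquivVia

/-! ### Switches along isomorphisms -/

/-- The intermediate object `G₁'` stays fixed, so the same pair and the same `P` serve again. -/
theorem IsSwitch.ofIsos {ρ₀ ρ₁ : Rule C} {G₀ G₁ G₁' G₂ H₀ H₁ H₂ : C}
    {d₀ : DirectDerivation ρ₀ G₀ G₁} {d₁ : DirectDerivation ρ₁ G₁ G₂}
    {e₀ : DirectDerivation ρ₁ G₀ G₁'} {e₁ : DirectDerivation ρ₀ G₁' G₂}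
    {d₀' : DirectDerivation ρ₀ H₀ H₁} {d₁' : DirectDerivation ρ₁ H₁ H₂}
    {φ₀ : G₀ ≅ H₀} {φ₁ : G₁ ≅ H₁} {φ₂ : G₂ ≅ H₂}
    (h : IsSwitch e₀ e₁ d₀ d₁) (h₀ : d₀.IsoVia φ₀ φ₁ d₀') (h₁ : d₁.IsoVia φ₁ φ₂ d₁') :
    IsSwitch (e₀.ofIsos φ₀ (Iso.refl G₁')) (e₁.ofIsos (Iso.refl G₁') φ₂) d₀' d₁' := by
  obtain ⟨p, ⟨p', hm₀, hh₁, hm₀', hh₁'⟩, P, p₀, p₁, q₀, q₁, hP, hq₀, hq, hq₁⟩ := h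
  obtain ⟨χ₀, m₀, k₀, t₀, f₀, g₀⟩ := h₀
  obtain ⟨χ₁, m₁, k₁, t₁, f₁, g₁⟩ := h₁
  refine ⟨⟨p.i₀, p.i₁, by simp [DirectDerivation.ofIsos, p.fac₀],
      by simp [DirectDerivation.ofIsos, p.fac₁]⟩,
    ⟨⟨p'.i₀ ≫ χ₁.hom, p'.i₁ ≫ χ₀.hom, ?_, ?_⟩, ?_, ?_, ?_, ?_⟩,
    P, p₀, p₁, q₀ ≫ χ₀.hom, q₁ ≫ χ₁.hom, ?_, ?_, ?_, ?_⟩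
  · rw [Category.assoc, ← f₁, reassoc_of% p'.fac₀, t₀]
  · rw [Category.assoc, ← g₀, reassoc_of% p'.fac₁, m₁]
  · simp [DirectDerivation.ofIsos, hm₀, f₀]
  · simp [DirectDerivation.ofIsos, hh₁, g₁]
  · simp [DirectDerivation.ofIsos, ← m₀, hm₀']
  · simp [DirectDerivation.ofIsos, ← t₁, hh₁']
  · simpa [DirectDerivation.ofIsos] using hP
  · simp [DirectDerivation.ofIsos, ← f₀, reassoc_of% hq₀]
  · simp [← g₀, ← f₁, reassoc_of% hq]
  · simp [DirectDerivation.ofIsos, ← g₁, reassoc_of% hq₁]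

/-! ### Lifting reductions of words to switching sequences -/

section Sequences

variable {R : Set (Rule C)}

theorem Shift.exists_of_absEquivVia {i : ℕ} {G H G' H' : C} {φ : G ≅ G'} {D E : Derivation R G H}
    {D' : Derivation R G' H'} (h : Shift i D E) (hD : AbsEquivVia φ D D') :
    ∃ E', Shift i D' E' ∧ AbsEquivVia φ E E' := by
  induction h generalizing G' H' with
  | head h₀ h₁ d₀ d₁ e₀ e₁ t hs =>
    cases hD with
    | cons _ _ φ₁ _ d₀' _ _ hd₀ hD =>
      cases hD with
      | cons _ _ φ₂ _ d₁' _ t' hd₁ ht =>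
        exact ⟨_, .head h₀ h₁ d₀' d₁' _ _ t' (hs.ofIsos hd₀ hd₁),
          .cons h₁ _ _ _ _ _ _ (e₀.isoVia_ofIsos _ _)
            (.cons h₀ _ _ _ _ _ _ (e₁.isoVia_ofIsos _ _) ht)⟩
  | tail hρ d t t' _ ih =>
    cases hD with
    | cons _ _ ψ _ d' _ _ hd ht =>
      obtain ⟨E', hs, he⟩ := ih ht
      exact ⟨_, .tail hρ d' _ _ hs, .cons hρ _ _ _ _ _ _ hd he⟩

theorem SwitchSeq.exists_of_absEquivVia {w : List ℕ} {G H G' H' : C} {φ : G ≅ G'}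
    {D E : Derivation R G H} {D' : Derivation R G' H'} (h : SwitchSeq w D E)
    (hD : AbsEquivVia φ D D') : ∃ E', SwitchSeq w D' E' ∧ AbsEquivVia φ E E' := by
  induction h generalizing D' with
  | nil D => exact ⟨D', .nil _, hD⟩
  | cons D E F hs _ ih =>
    obtain ⟨E', hs', hE⟩ := hs.exists_of_absEquivVia hD
    obtain ⟨F', hw, hF⟩ := ih hE
    exact ⟨F', .cons _ _ _ hs' hw, hF⟩

theorem switchSeq_append_iff {u w : List ℕ} {G H : C} {D F : Derivation R G H} :
    SwitchSeq (u ++ w) D F ↔ ∃ E, SwitchSeq u D E ∧ SwitchSeq w E F := by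
  induction u generalizing D with
  | nil => exact ⟨fun h => ⟨D, .nil D, h⟩, fun ⟨E, h, h'⟩ => by cases h; exact h'⟩
  | cons i u ih =>
    constructor
    · rintro (_ | ⟨_, E, _, hs, h⟩)
      obtain ⟨E', h, h'⟩ := ih.1 h
      exact ⟨E', .cons _ _ _ hs h, h'⟩
    · rintro ⟨E, _ | ⟨_, E', _, hs, h⟩, h'⟩
      exact .cons _ _ _ hs (ih.2 ⟨E, h, h'⟩)

/-- The two switches touch disjoint pairs of steps, so no category theory is needed. -/
theorem Shift.comm_of_lt {i j : ℕ} {G H : C} {D E F : Derivation R G H} (h : Shift i D E)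
    (h' : Shift j E F) (hij : i + 1 < j) : ∃ E', Shift j D E' ∧ Shift i E' F := by
  induction h generalizing j with
  | head h₀ h₁ d₀ d₁ e₀ e₁ t hs =>
    cases h' with
    | head => omega
    | tail _ _ _ _ h' =>
      cases h' with
      | head => omega
      | tail _ _ _ _ h' =>
        exact ⟨_, .tail _ _ _ _ (.tail _ _ _ _ h'), .head _ _ _ _ _ _ _ hs⟩
  | tail hρ d t t' _ ih =>
    cases h' with
    | head => omega
    | tail _ _ _ _ h' =>
      obtain ⟨E', h₁, h₂⟩ := ih h' (by omega)
      exact ⟨_, .tail _ _ _ _ h₁, .tail _ _ _ _ h₂⟩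

variable {M : MorphismProperty C}

/-- Strong enforcing applies both to the pair of the given steps and to the reverse pair of the
switched ones. -/
theorem IsSwitch.nonempty_switchSquare (hM : IsMAdhesive M) (hR : IsLeftLinear M R)
    (hW : IsStrongEnforcing R) {ρ₀ ρ₁ : Rule C} (h₀ : ρ₀ ∈ R) (h₁ : ρ₁ ∈ R) {G₀ G₁ G₁' G₂ : C}
    {d₀ : DirectDerivation ρ₀ G₀ G₁} {d₁ : DirectDerivation ρ₁ G₁ G₂}
    {e₀ : DirectDerivation ρ₁ G₀ G₁'} {e₁ : DirectDerivation ρ₀ G₁' G₂}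
    (h : IsSwitch d₀ d₁ e₀ e₁) : Nonempty (SwitchSquare d₀ d₁ e₀ e₁) := by
  obtain ⟨p, hp⟩ := h
  exact SwitchSquare.nonempty_of_isSwitchAlong hM (hR _ h₀) (hR _ h₁) (hW h₁ h₀ _ _)
    (hW h₀ h₁ _ _ p) hp

theorem Shift.symm (hM : IsMAdhesive M) (hR : IsLeftLinear M R) (hW : IsStrongEnforcing R) {i : ℕ}
    {G H : C} {D E : Derivation R G H} (h : Shift i D E) : Shift i E D := by
  induction h with
  | head h₀ h₁ d₀ d₁ e₀ e₁ t hs =>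
    obtain ⟨s⟩ := hs.nonempty_switchSquare hM hR hW h₁ h₀
    exact .head h₁ h₀ _ _ _ _ t (s.symm.isSwitch hM (hR _ h₁))
  | tail hρ d t t' _ ih => exact .tail hρ d _ _ ih

/-- Switching the same steps twice gives an isomorphic derivation. -/
theorem Shift.absEquivVia_of_shift (hM : IsMAdhesive M) (hR : IsLeftLinear M R)
    (hW : IsWellSwitching R) {i : ℕ} {G H : C} {D E F : Derivation R G H} (h : Shift i D E)
    (h' : Shift i E F) : AbsEquivVia (Iso.refl G) F D := by
  induction h with
  | head h₀ h₁ d₀ d₁ e₀ e₁ t hs =>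
    cases h' with
    | head _ _ _ _ c₀ c₁ _ hs' =>
      obtain ⟨s⟩ := hs.nonempty_switchSquare hM hR hW.1 h₁ h₀
      obtain ⟨s'⟩ := hs'.nonempty_switchSquare hM hR hW.1 h₀ h₁
      -- `D` and `F` are both switches of `E`; the uniqueness of independence pairs makes them
      -- switches along the same pair.
      have hi := congrArg IndependencePair.i₁ (hW.2 h₁ h₀ _ _ s'.symm.pair s.pair)
      obtain ⟨θ, hθ₀, hθ₁⟩ := s'.symm.exists_isoVia hM (hR _ h₁) (hR _ h₀) s hi
      exact .cons h₀ _ θ _ _ _ _ hθ₀ (.cons h₁ _ _ _ _ _ _ hθ₁ (.refl t))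
  | tail hρ d t t' _ ih =>
    cases h' with
    | tail _ _ _ _ h' => exact .cons hρ _ _ _ _ _ _ (.refl d) (ih h')

/-- The braid relation for derivations. -/
theorem Shift.braid (hM : IsMAdhesive M) (hR : IsLeftLinear M R)
    (hW : IsStrongEnforcing R) {i : ℕ} {G H : C} {D E F K : Derivation R G H} (h : Shift i D E)
    (h' : Shift (i + 1) E F) (h'' : Shift i F K) :
    ∃ E' F' K', Shift (i + 1) D E' ∧ Shift i E' F' ∧ Shift (i + 1) F' K' ∧
      AbsEquivVia (Iso.refl G) K K' := by
  induction h with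
  | head h₀ h₁ d₀ d₁ e₀ e₁ t hs =>
    rcases h' with _ | ⟨_, _, _, _, h'⟩
    rcases h' with @⟨_, _, _, _, _, _, ρ₂, _, h₂, _, d₂, f₁, f₂, t, hs'⟩
    rcases h'' with @⟨_, _, _, _, _, _, _, _, _, _, _, k₀, k₁, _, hs''⟩
    obtain ⟨s₁⟩ := hs.nonempty_switchSquare hM hR hW h₁ h₀
    obtain ⟨s₂⟩ := hs'.nonempty_switchSquare hM hR hW h₂ h₀
    obtain ⟨s₃⟩ := hs''.nonempty_switchSquare hM hR hW h₂ h₁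
    obtain ⟨_, _, _, a₁, a₂, b₀, b₁, c₁, c₂, ⟨s₄⟩, ⟨s₅⟩, ⟨s₆⟩, ψ₂, ψ₁₂, g₀, g₁, g₂⟩ :=
      SwitchSquare.braid hM hR hW h₀ h₁ h₂ s₁.symm s₂.symm s₃.symm
    exact ⟨_, _, _,
      .tail h₀ d₀ _ _ (.head h₁ h₂ _ _ _ _ t (s₄.symm.isSwitch hM (hR _ h₁))),
      .head h₀ h₂ _ _ _ _ _ (s₅.symm.isSwitch hM (hR _ h₀)),
      .tail h₂ b₀ _ _ (.head h₀ h₁ _ _ _ _ t (s₆.symm.isSwitch hM (hR _ h₀))),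
      .cons h₂ _ ψ₂ _ _ _ _ g₀ (.cons h₁ _ ψ₁₂ _ _ _ _ g₁
        (.cons h₀ _ _ _ _ _ _ g₂ (.refl t)))⟩
  | tail hρ d t t' _ ih =>
    rcases h' with _ | ⟨_, _, _, _, h'⟩
    rcases h'' with _ | ⟨_, _, _, _, h''⟩
    obtain ⟨E', F', K', h₁, h₂, h₃, h₄⟩ := ih h' h''
    exact ⟨_, _, _, .tail hρ d _ _ h₁, .tail hρ d _ _ h₂, .tail hρ d _ _ h₃,
      .cons hρ _ _ _ _ _ _ (.refl d) h₄⟩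

theorem switchSeq_cons_iff {i : ℕ} {w : List ℕ} {G H : C} {D F : Derivation R G H} :
    SwitchSeq (i :: w) D F ↔ ∃ E, Shift i D E ∧ SwitchSeq w E F := by
  constructor
  · rintro (_ | ⟨_, E, _, hs, h⟩)
    exact ⟨E, hs, h⟩
  · rintro ⟨E, hs, h⟩
    exact .cons _ _ _ hs h

/-- Reductions of words lift to switching sequences, up to isomorphism of the last derivation. -/
theorem WordReduces.exists_switchSeq (hM : IsMAdhesive M) (hR : IsLeftLinear M R)
    (hW : IsWellSwitching R) {w w' : List ℕ} (h : WordReduces w w') {G H : C}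
    {D E : Derivation R G H} (hw : SwitchSeq w D E) :
    ∃ E', SwitchSeq w' D E' ∧ AbsEquivVia (Iso.refl G) E E' := by
  induction h generalizing D E with
  | refl w => exact ⟨E, hw, .refl E⟩
  | trans _ _ ih₁ ih₂ =>
    obtain ⟨E', hw', hE⟩ := ih₁ hw
    obtain ⟨E'', hw'', hE'⟩ := ih₂ hw'
    exact ⟨E'', hw'', by simpa using hE.trans hE'⟩
  | context x y _ ih =>
    obtain ⟨B, hB, hy⟩ := switchSeq_append_iff.1 hw
    obtain ⟨A, hx, hA⟩ := switchSeq_append_iff.1 hB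
    obtain ⟨B', hA', hBB⟩ := ih hA
    -- The reduced middle part ends only at an isomorphic derivation, so the switches of `y` are
    -- transported along that isomorphism.
    obtain ⟨E', hy', hE⟩ := hy.exists_of_absEquivVia hBB
    exact ⟨E', switchSeq_append_iff.2 ⟨B', switchSeq_append_iff.2 ⟨A, hx, hA'⟩, hy'⟩, hE⟩
  | cancel i =>
    simp only [switchSeq_cons_iff] at hw
    obtain ⟨A, hA, B, hB, _ | _⟩ := hw
    exact ⟨D, .nil D, hA.absEquivVia_of_shift hM hR hW hB⟩
  | comm_lt hij =>
    simp only [switchSeq_cons_iff] at hw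
    obtain ⟨A, hA, B, hB, _ | _⟩ := hw
    obtain ⟨A', hA', hB'⟩ := hA.comm_of_lt hB hij
    exact ⟨E, .cons _ _ _ hA' (.cons _ _ _ hB' (.nil E)), .refl E⟩
  | comm_gt hij =>
    simp only [switchSeq_cons_iff] at hw
    obtain ⟨A, hA, B, hB, _ | _⟩ := hw
    -- Read backwards, the sequence switches the smaller position first, which is the case already
    -- settled.
    obtain ⟨A', hA', hB'⟩ :=
      (hB.symm hM hR hW.1).comm_of_lt (hA.symm hM hR hW.1) hij
    exact ⟨E, .cons _ _ _ (hB'.symm hM hR hW.1)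
      (.cons _ _ _ (hA'.symm hM hR hW.1) (.nil E)), .refl E⟩
  | braid i =>
    simp only [switchSeq_cons_iff] at hw
    obtain ⟨A, hA, B, hB, K, hK, _ | _⟩ := hw
    obtain ⟨A', B', K', h₁, h₂, h₃, h₄⟩ := hA.braid hM hR hW.1 hB hK
    exact ⟨K', .cons _ _ _ h₁ (.cons _ _ _ h₂ (.cons _ _ _ h₃ (.nil K'))), h₄⟩

theorem WordReduces.switchesTo (hM : IsMAdhesive M) (hR : IsLeftLinear M R)
    (hW : IsWellSwitching R) {w w' : List ℕ} (h : WordReduces w w') {G H G' H' : C}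
    {D : Derivation R G H} {D' : Derivation R G' H'} (hw : SwitchesTo w D D') :
    SwitchesTo w' D D' := by
  obtain ⟨G₀, H₀, D₀, Dₘ, hD, hs, φ, hD'⟩ := hw
  obtain ⟨E, hs', hE⟩ := h.exists_switchSeq hM hR hW hs
  exact ⟨G₀, H₀, D₀, E, hD, hs', _, hE.symm.trans hD'⟩

end Sequences

end DPO

theorem mainTheorem2 {C : Type u} [CategoryTheory.Category.{v} C]
    (M : CategoryTheory.MorphismProperty C) (hM : DPO.IsMAdhesive M)
    (R : Set (DPO.Rule C)) (hR : DPO.IsLeftLinear M R) (hW : DPO.IsWellSwitching R)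
    {G H G' H' : C} (D : DPO.Derivation R G H) (D' : DPO.Derivation R G' H')
    (σ : Equiv.Perm ℕ) (hσ : DPO.SwitchEquiv σ D D') :
    ∃! w : List ℕ, DPO.composite w = σ ∧ DPO.IsCanonical w ∧ DPO.SwitchesTo w D D' := by
  obtain ⟨w, rfl, hw⟩ := hσ
  obtain ⟨w', h, hc⟩ := DPO.WordReduces.exists_isCanonical w
  exact ⟨w', ⟨h.composite_eq.symm, hc, h.switchesTo hM hR hW hw⟩,
    fun v hv => hv.2.1.ext hc (hv.1.trans h.composite_eq)⟩
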